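/- Let $M$ be a connected oriented smooth three-manifold with a Lorentzian metric $g$ of signature $(-,+,+)$, Levi-Civita connection $\nabla$ and Lorentzian volume form $\nu$. Vector fields and one-forms are identified through $g$, and $\ast w = w\lrcorner\nu$ and $\ast(w_1\wedge w_2) = w_2\lrcorner(w_1\lrcorner\nu)$ for one-forms $w,w_1,w_2$. Suppose that $(M,g,u,\mathfrak{f})$ is a skew-torsion Lorentzian three-manifold, that is, $\mathfrak{f}\in C^{\infty}(M)$ and $u$ is a nowhere vanishing isotropic smooth one-form with $$\nabla u = \mathfrak{f}\ast u .$$ Let $(u,v,n)$ be any null coframe associated to $u$, that is, $v$ is a smooth isotropic one-form with $g(u,v)=1$ and $n=-\ast(u\wedge v)$. Then there are a smooth one-form $\kappa$ and a smooth function $\mathfrak{l}$ such that $$\nabla u = \mathfrak{f}\, n\wedge u,\qquad \nabla v = \kappa\otimes n - \mathfrak{f}\, n\otimes v,\qquad \nabla n = \mathfrak{f}\, u\otimes v - \kappa\otimes u,$$ where the first tensor factor is the direction of differentiation, and $$\mathrm{d}\kappa = \mathrm{d}\mathfrak{f}(v)\, v\wedge u + \big(\mathrm{d}\mathfrak{f}(n)+\mathfrak{f}^2+\kappa(u)\,\mathfrak{f}\big)\,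 v\wedge n + \mathfrak{l}\, u\wedge n .$$ For any such $\kappa$ and $\mathfrak{l}$, the metric $g$ is Einstein (that is, $\mathrm{Ric}^g = c\, g$ for some constant $c\in\mathbb{R}$) if and only if $\mathfrak{f}$ is constant and $\mathfrak{f}\,\kappa(v) = \mathfrak{l}$ on $M$. -/

import Mathlib

open scoped Manifold ContDiff Bundle
open VectorField FiberBundle

noncomputable section

section LeviCivita

variable {E : Type*} [NormedAddCommGroup E] [NormedSpace ℝ E]
  {H : Type*} [TopologicalSpace H]

/-- A smooth pseudo-Riemannian metric on a smooth manifold. -/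
structure PseudoRiemannianMetric (I : ModelWithCorners ℝ E H) (M : Type*) [TopologicalSpace M]
    [ChartedSpace H M] [IsManifold I ∞ M] where
  inner (x : M) : TangentSpace I x →L[ℝ] TangentSpace I x →L[ℝ] ℝ
  symm (x : M) (v w : TangentSpace I x) : inner x v w = inner x w v
  nondegenerate (x : M) (v : TangentSpace I x) (hv : ∀ w, inner x v w = 0) : v = 0
  contMDiff : ContMDiff I (I.prod 𝓘(ℝ, E →L[ℝ] E →L[ℝ] ℝ)) ∞
    (fun x ↦ Bundle.TotalSpace.mk' (E →L[ℝ] E →L[ℝ] ℝ) x (inner x))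

variable {I : ModelWithCorners ℝ E H} {M : Type*} [TopologicalSpace M]
    [ChartedSpace H M] [IsManifold I ∞ M]

namespace PseudoRiemannianMetric

variable (g : PseudoRiemannianMetric I M)

theorem mdifferentiableAt_inner {X Y : Π x : M, TangentSpace I x} {x : M}
    (hX : MDiffAt (T% X) x) (hY : MDiffAt (T% Y) x) :
    MDiffAt (fun y ↦ g.inner y (X y) (Y y)) x := by
  have : MDifferentiableAt I (I.prod 𝓘(ℝ))
      (fun m ↦ Bundle.TotalSpace.mk' ℝ (E := Bundle.Trivial M ℝ) m (g.inner m (X m) (Y m))) x := by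
    apply MDifferentiableAt.clm_bundle_apply₂ (F₁ := E) (F₂ := E)
    · exact (g.contMDiff x).mdifferentiableAt (by simp)
    · exact hX
    · exact hY
  simp only [mdifferentiableAt_totalSpace] at this
  exact this.2

/-- The Koszul expression, equal to `2 g(∇_X Y, Z)` for the Levi-Civita connection `∇`. -/
def koszul (X Y Z : Π x : M, TangentSpace I x) (x : M) : ℝ :=
  mvfderiv I (fun y ↦ g.inner y (Y y) (Z y)) x (X x)
    + mvfderiv I (fun y ↦ g.inner y (X y) (Z y)) x (Y x)
    - mvfderiv I (fun y ↦ g.inner y (X y) (Y y)) x (Z x)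
    + g.inner x (mlieBracket I X Y x) (Z x)
    - g.inner x (mlieBracket I X Z x) (Y x)
    - g.inner x (mlieBracket I Y Z x) (X x)


theorem koszul_tensorial₁ [CompleteSpace E] {Y Z : Π x : M, TangentSpace I x} {x : M}
    (hY : MDiffAt (T% Y) x) (hZ : MDiffAt (T% Z) x) :
    TensorialAt I E (fun X ↦ g.koszul X Y Z x) x where
  smul {f X} hf hX := by
    have h1 := mvfderiv_fun_mul hf (g.mdifferentiableAt_inner hX hZ)
    have h2 := mvfderiv_fun_mul hf (g.mdifferentiableAt_inner hX hY)
    simp [koszul, mlieBracket_smul_left hf hX, h1, h2]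
    ring
  add {X X'} hX hX' := by
    have h1 := mvfderiv_fun_add (g.mdifferentiableAt_inner hX hZ) (g.mdifferentiableAt_inner hX' hZ)
    have h2 := mvfderiv_fun_add (g.mdifferentiableAt_inner hX hY) (g.mdifferentiableAt_inner hX' hY)
    simp [koszul, mlieBracket_add_left hX hX', h1, h2]
    ring

theorem koszul_tensorial₃ [CompleteSpace E] {X Y : Π x : M, TangentSpace I x} {x : M}
    (hX : MDiffAt (T% X) x) (hY : MDiffAt (T% Y) x) :
    TensorialAt I E (fun Z ↦ g.koszul X Y Z x) x where
  smul {f Z} hf hZ := by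
    have h1 := mvfderiv_fun_mul hf (g.mdifferentiableAt_inner hX hZ)
    have h2 := mvfderiv_fun_mul hf (g.mdifferentiableAt_inner hY hZ)
    simp [koszul, mlieBracket_smul_right hf hZ, h1, h2, g.symm x (Z x)]
    ring
  add {Z Z'} hZ hZ' := by
    have h1 := mvfderiv_fun_add (g.mdifferentiableAt_inner hX hZ) (g.mdifferentiableAt_inner hX hZ')
    have h2 := mvfderiv_fun_add (g.mdifferentiableAt_inner hY hZ) (g.mdifferentiableAt_inner hY hZ')
    simp [koszul, mlieBracket_add_right hZ hZ', h1, h2]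
    ring

theorem ext_inner {x : M} {v v' : TangentSpace I x} (h : ∀ w, g.inner x v w = g.inner x v' w) :
    v = v' :=
  sub_eq_zero.1 (g.nondegenerate x _ fun w ↦ by simp [h])

variable [FiniteDimensional ℝ E]

/-- The musical isomorphism `TM ≃ T*M`, `v ↦ g(v, ·)`, at a point. -/
def flatEquiv (x : M) : TangentSpace I x ≃ₗ[ℝ] (TangentSpace I x →L[ℝ] ℝ) :=
  haveI : FiniteDimensional ℝ (TangentSpace I x) := inferInstanceAs (FiniteDimensional ℝ E)
  haveI : T2Space (TangentSpace I x) := inferInstanceAs (T2Space E)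
  LinearEquiv.ofInjectiveOfFinrankEq (g.inner x).toLinearMap
    ((injective_iff_map_eq_zero _).2 fun v hv ↦ g.nondegenerate x v fun w ↦ by
      simpa using congr($hv w))
    (by
      rw [← (LinearMap.toContinuousLinearMap (𝕜 := ℝ) (E := TangentSpace I x)
        (F' := ℝ)).finrank_eq, Module.finrank_linearMap_self])


open Classical in
/-- The lowered covariant derivative `w ↦ g(∇_w Y, ·)` at `x`, given by Koszul's formula (and set
to be zero if `Y` is not differentiable at `x`). -/
def leviCivitaLower (Y : Π x : M, TangentSpace I x) (x : M) :
    TangentSpace I x →L[ℝ] TangentSpace I x →L[ℝ] ℝ :=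
  haveI : CompleteSpace E := FiniteDimensional.complete ℝ E
  if hY : MDiffAt (T% Y) x then
    (1 / 2 : ℝ) • TensorialAt.mkHom₂ (fun X Z ↦ g.koszul X Y Z x) x
      (fun _ hZ ↦ g.koszul_tensorial₁ hY hZ) (fun _ hX ↦ g.koszul_tensorial₃ hX hY)
  else 0

theorem leviCivitaLower_apply {X Y Z : Π x : M, TangentSpace I x} {x : M}
    (hX : MDiffAt (T% X) x) (hY : MDiffAt (T% Y) x) (hZ : MDiffAt (T% Z) x) :
    g.leviCivitaLower Y x (X x) (Z x) = 1 / 2 * g.koszul X Y Z x := by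
  have : CompleteSpace E := FiniteDimensional.complete ℝ E
  rw [leviCivitaLower, dif_pos hY]
  change (1 / 2 : ℝ) * TensorialAt.mkHom₂ (fun X Z ↦ g.koszul X Y Z x) x
    (fun _ hZ ↦ g.koszul_tensorial₁ hY hZ) (fun _ hX ↦ g.koszul_tensorial₃ hX hY) (X x) (Z x) = _
  rw [TensorialAt.mkHom₂_apply _ _ hX hZ]

/-- The endomorphism `w ↦ ∇_w Y` of the tangent space at `x`. -/
def leviCivitaFun (Y : Π x : M, TangentSpace I x) (x : M) :
    TangentSpace I x →L[ℝ] TangentSpace I x :=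
  haveI : FiniteDimensional ℝ (TangentSpace I x) := inferInstanceAs (FiniteDimensional ℝ E)
  haveI : T2Space (TangentSpace I x) := inferInstanceAs (T2Space E)
  LinearMap.toContinuousLinearMap
    ((g.flatEquiv x).symm.toLinearMap ∘ₗ (g.leviCivitaLower Y x).toLinearMap)

theorem inner_leviCivitaFun (Y : Π x : M, TangentSpace I x) (x : M) (v w : TangentSpace I x) :
    g.inner x (g.leviCivitaFun Y x v) w = g.leviCivitaLower Y x v w := by
  have h : g.flatEquiv x (g.leviCivitaFun Y x v) = g.leviCivitaLower Y x v :=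
    (g.flatEquiv x).apply_symm_apply _
  exact congr($h w)

theorem inner_leviCivitaFun_eq_koszul {X Y Z : Π x : M, TangentSpace I x} {x : M}
    (hX : MDiffAt (T% X) x) (hY : MDiffAt (T% Y) x) (hZ : MDiffAt (T% Z) x) :
    g.inner x (g.leviCivitaFun Y x (X x)) (Z x) = 1 / 2 * g.koszul X Y Z x := by
  rw [inner_leviCivitaFun, g.leviCivitaLower_apply hX hY hZ]

/-- The Levi-Civita connection of `g`; `g.leviCivita Y x w` is `∇_w Y` at `x`. -/
def leviCivita : CovariantDerivative I E (TangentSpace I : M → Type _) where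
  toFun := g.leviCivitaFun
  isCovariantDerivativeOnUniv :=
    haveI : CompleteSpace E := FiniteDimensional.complete ℝ E
    { add := fun {Y Y' x} hY hY' _ ↦ by
        ext1 v
        refine g.ext_inner fun w ↦ ?_
        have hv := mdifferentiableAt_extend I E v
        have hw := mdifferentiableAt_extend I E w
        have k := g.inner_leviCivitaFun_eq_koszul hv (mdifferentiableAt_add_section hY hY') hw
        have k1 := g.inner_leviCivitaFun_eq_koszul hv hY hw
        have k2 := g.inner_leviCivitaFun_eq_koszul hv hY' hw
        simp only [extend_apply_self] at k k1 k2
        have h1 := mvfderiv_fun_add (g.mdifferentiableAt_inner hY hw)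
          (g.mdifferentiableAt_inner hY' hw)
        have h2 := mvfderiv_fun_add (g.mdifferentiableAt_inner hv hY)
          (g.mdifferentiableAt_inner hv hY')
        simp only [add_apply, map_add]
        rw [k, k1, k2]
        simp [koszul, mlieBracket_add_left hY hY', mlieBracket_add_right hY hY', h1, h2]
        ring
      leibniz := fun {Y f x} hY hf _ ↦ by
        ext1 v
        refine g.ext_inner fun w ↦ ?_
        have hv := mdifferentiableAt_extend I E v
        have hw := mdifferentiableAt_extend I E w
        have k := g.inner_leviCivitaFun_eq_koszul hv (hf.smul_section hY) hw
        have k1 := g.inner_leviCivitaFun_eq_koszul hv hY hw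
        simp only [extend_apply_self] at k k1
        have h1 := mvfderiv_fun_mul hf (g.mdifferentiableAt_inner hY hw)
        have h2 := mvfderiv_fun_mul hf (g.mdifferentiableAt_inner hv hY)
        simp only [add_apply, map_add, smul_apply, map_smul]
        rw [k, k1]
        simp [koszul, mlieBracket_smul_left hf hY, mlieBracket_smul_right hf hY, h1, h2,
          g.symm x v (Y x)]
        ring }

/-- The Levi-Civita connection is torsion-free. -/
theorem leviCivita_torsion_free {X Y : Π x : M, TangentSpace I x} {x : M}
    (hX : MDiffAt (T% X) x) (hY : MDiffAt (T% Y) x) :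
    g.leviCivita Y x (X x) - g.leviCivita X x (Y x) = mlieBracket I X Y x := by
  have : CompleteSpace E := FiniteDimensional.complete ℝ E
  refine g.ext_inner fun w ↦ ?_
  have hw := mdifferentiableAt_extend I E w
  have k1 := g.inner_leviCivitaFun_eq_koszul hX hY hw
  have k2 := g.inner_leviCivitaFun_eq_koszul hY hX hw
  simp only [extend_apply_self] at k1 k2
  have e : (fun y ↦ g.inner y (Y y) (X y)) = fun y ↦ g.inner y (X y) (Y y) := by
    ext y; exact g.symm _ _ _
  change g.inner x (g.leviCivitaFun Y x (X x) - g.leviCivitaFun X x (Y x)) w = _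
  rw [map_sub, sub_apply, k1, k2]
  simp [koszul, e, mlieBracket_swap_apply (V := Y) (W := X)]
  ring

/-- The Levi-Civita connection is metric. -/
theorem leviCivita_metric {X Y Z : Π x : M, TangentSpace I x} {x : M}
    (hX : MDiffAt (T% X) x) (hY : MDiffAt (T% Y) x) (hZ : MDiffAt (T% Z) x) :
    mvfderiv I (fun y ↦ g.inner y (Y y) (Z y)) x (X x) =
      g.inner x (g.leviCivita Y x (X x)) (Z x) + g.inner x (Y x) (g.leviCivita Z x (X x)) := by
  have k1 := g.inner_leviCivitaFun_eq_koszul hX hY hZ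
  have k2 := g.inner_leviCivitaFun_eq_koszul hX hZ hY
  have e : (fun y ↦ g.inner y (Z y) (Y y)) = fun y ↦ g.inner y (Y y) (Z y) := by
    ext y; exact g.symm _ _ _
  rw [g.symm x (Y x)]
  change _ = g.inner x (g.leviCivitaFun Y x (X x)) (Z x)
    + g.inner x (g.leviCivitaFun Z x (X x)) (Y x)
  rw [k1, k2]
  simp [koszul, e, mlieBracket_swap_apply (V := Z) (W := Y)]
  ring

/-- The curvature `R(X, Y) Z = ∇_X ∇_Y Z - ∇_Y ∇_X Z - ∇_[X, Y] Z` of vector fields. -/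
def curvature (X Y Z : Π x : M, TangentSpace I x) (x : M) : TangentSpace I x :=
  g.leviCivita (fun y ↦ g.leviCivita Z y (Y y)) x (X x)
    - g.leviCivita (fun y ↦ g.leviCivita Z y (X y)) x (Y x)
    - g.leviCivita Z x (mlieBracket I X Y x)

/-- The Ricci tensor `Ric(v, w) = tr (a ↦ R(a, v) w)`. Tangent vectors at `x` are extended to vector
fields that are smooth near `x`, and the trace is computed in a basis of the tangent space. -/
def ricci (x : M) (v w : TangentSpace I x) : ℝ :=
  haveI : FiniteDimensional ℝ (TangentSpace I x) := inferInstanceAs (FiniteDimensional ℝ E)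
  ∑ i, (Module.finBasis ℝ (TangentSpace I x)).coord i
    (g.curvature (extend E (Module.finBasis ℝ (TangentSpace I x) i)) (extend E v) (extend E w) x)

/-- `g` is an Einstein metric: `Ric = c g` for a real constant `c`. -/
def IsEinstein : Prop :=
  ∃ c : ℝ, ∀ (x : M) (v w : TangentSpace I x), g.ricci x v w = c * g.inner x v w

end PseudoRiemannianMetric

/-- The exterior derivative of a one-form, evaluated on vector fields:
`dκ(X, Y) = X(κ(Y)) - Y(κ(X)) - κ([X, Y])`. -/
def extDerivOneForm (κ : Π x : M, TangentSpace I x →L[ℝ] ℝ) (X Y : Π x : M, TangentSpace I x)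
    (x : M) : ℝ :=
  mvfderiv I (fun y ↦ κ y (Y y)) x (X x) - mvfderiv I (fun y ↦ κ y (X y)) x (Y x)
    - κ x (mlieBracket I X Y x)

/-- The wedge product of two covectors, `(α ∧ β)(v, w) = α(v) β(w) - α(w) β(v)`. -/
def wedge {x : M} (α β : TangentSpace I x →L[ℝ] ℝ) (v w : TangentSpace I x) : ℝ :=
  α v * β w - α w * β v

end LeviCivita

section SkewTorsion

variable {M : Type*} [TopologicalSpace M] [ChartedSpace (EuclideanSpace ℝ (Fin 3)) M]
  [IsManifold (𝓡 3) ∞ M]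

/-- `X` is a smooth vector field. -/
def IsSmoothField (X : Π x : M, TangentSpace (𝓡 3) x) : Prop :=
  ContMDiff (𝓡 3) (𝓡 3).tangent ∞ (fun x ↦ (⟨x, X x⟩ : TangentBundle (𝓡 3) M))

/-- A triple of tangent vectors is orthonormal in signature `(-, +, +)`. -/
def IsLorentzOrthonormal (g : PseudoRiemannianMetric (𝓡 3) M) (x : M)
    (e : Fin 3 → TangentSpace (𝓡 3) x) : Prop :=
  ∀ i j, g.inner x (e i) (e j) = if i = j then (![-1, 1, 1] : Fin 3 → ℝ) i else 0

/-- The metric of a three-manifold is Lorentzian, of signature `(-, +, +)`. -/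
def IsLorentzian (g : PseudoRiemannianMetric (𝓡 3) M) : Prop :=
  ∀ x, ∃ e : Fin 3 → TangentSpace (𝓡 3) x, IsLorentzOrthonormal g x e

/-- `ν` is the Lorentzian volume form of `g` for one of the orientations of `M`: a smooth three-form
with values `±1` on orthonormal frames. The choice of `ν` is the choice of an orientation. -/
structure IsLorentzVolumeForm (g : PseudoRiemannianMetric (𝓡 3) M)
    (ν : Π x : M, TangentSpace (𝓡 3) x [⋀^Fin 3]→ₗ[ℝ] ℝ) : Prop where
  smooth : ∀ X Y Z : Π x : M, TangentSpace (𝓡 3) x,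
    IsSmoothField X → IsSmoothField Y → IsSmoothField Z →
    ContMDiff (𝓡 3) 𝓘(ℝ) ∞ (fun x ↦ ν x ![X x, Y x, Z x])
  unit : ∀ x (e : Fin 3 → TangentSpace (𝓡 3) x), IsLorentzOrthonormal g x e →
    ν x e = 1 ∨ ν x e = -1

/-- The two-form `∗α = α^♯ ⌟ ν` at `x`, for the covector `α = g(a, ·)`. -/
def hodgeStarOne (ν : Π x : M, TangentSpace (𝓡 3) x [⋀^Fin 3]→ₗ[ℝ] ℝ) (x : M)
    (a v w : TangentSpace (𝓡 3) x) : ℝ :=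
  ν x ![a, v, w]

/-- The covector `∗(α ∧ β) = β^♯ ⌟ (α^♯ ⌟ ν)` at `x`, for `α = g(a, ·)` and `β = g(b, ·)`. -/
def hodgeStarTwo (ν : Π x : M, TangentSpace (𝓡 3) x [⋀^Fin 3]→ₗ[ℝ] ℝ) (x : M)
    (a b v : TangentSpace (𝓡 3) x) : ℝ :=
  ν x ![a, b, v]

/-- `(M, g, u, f)` is a skew-torsion Lorentzian three-manifold, oriented by the volume form `ν`. The
one-form is given by its metric dual, the vector field `U`, so that `u = g(U, ·)`; it is smooth,
isotropic and nowhere zero and satisfies `∇u = f ∗u`. -/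
structure IsSkewTorsion (g : PseudoRiemannianMetric (𝓡 3) M)
    (ν : Π x : M, TangentSpace (𝓡 3) x [⋀^Fin 3]→ₗ[ℝ] ℝ)
    (U : Π x : M, TangentSpace (𝓡 3) x) (f : M → ℝ) : Prop where
  lorentzian : IsLorentzian g
  volume : IsLorentzVolumeForm g ν
  smooth_function : ContMDiff (𝓡 3) 𝓘(ℝ) ∞ f
  smooth : IsSmoothField U
  ne_zero : ∀ x, U x ≠ 0
  isotropic : ∀ x, g.inner x (U x) (U x) = 0
  parallel : ∀ (x : M) (v w : TangentSpace (𝓡 3) x),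
    g.inner x (g.leviCivita U x v) w = f x * hodgeStarOne ν x (U x) v w

/-- `(u, v, n)` is a null coframe associated to `u`, given by the metric duals `U`, `V`, `N`: the
field `V` is isotropic and conjugate to `U`, and `n = -∗(u ∧ v)`. -/
structure IsNullCoframe (g : PseudoRiemannianMetric (𝓡 3) M)
    (ν : Π x : M, TangentSpace (𝓡 3) x [⋀^Fin 3]→ₗ[ℝ] ℝ)
    (U V N : Π x : M, TangentSpace (𝓡 3) x) : Prop where
  smooth_v : IsSmoothField V
  smooth_n : IsSmoothField N
  isotropic : ∀ x, g.inner x (V x) (V x) = 0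
  conjugate : ∀ x, g.inner x (U x) (V x) = 1
  screen : ∀ (x : M) (w : TangentSpace (𝓡 3) x),
    g.inner x (N x) w = -hodgeStarTwo ν x (U x) (V x) w

/-- The one-form `κ` of a null coframe: it is smooth and
`∇u = f n ∧ u`, `∇v = κ ⊗ n - f n ⊗ v`, `∇n = f u ⊗ v - κ ⊗ u`,
where the first tensor factor is the direction of differentiation. -/
structure IsConnectionForm (g : PseudoRiemannianMetric (𝓡 3) M)
    (U V N : Π x : M, TangentSpace (𝓡 3) x) (f : M → ℝ)
    (κ : Π x : M, TangentSpace (𝓡 3) x →L[ℝ] ℝ) : Prop where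
  smooth : ContMDiff (𝓡 3) ((𝓡 3).prod 𝓘(ℝ, EuclideanSpace ℝ (Fin 3) →L[ℝ] ℝ)) ∞
    (fun x ↦ Bundle.TotalSpace.mk' (EuclideanSpace ℝ (Fin 3) →L[ℝ] ℝ)
      (E := fun x : M ↦ TangentSpace (𝓡 3) x →L[ℝ] ℝ) x (κ x))
  nabla_u : ∀ (x : M) (w : TangentSpace (𝓡 3) x),
    g.leviCivita U x w = (f x * g.inner x (N x) w) • U x - (f x * g.inner x (U x) w) • N x
  nabla_v : ∀ (x : M) (w : TangentSpace (𝓡 3) x),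
    g.leviCivita V x w = κ x w • N x - (f x * g.inner x (N x) w) • V x
  nabla_n : ∀ (x : M) (w : TangentSpace (𝓡 3) x),
    g.leviCivita N x w = (f x * g.inner x (U x) w) • V x - κ x w • U x

/-- The function `l` of a null coframe: it is smooth and
`dκ = df(v) v ∧ u + (df(n) + f² + κ(u) f) v ∧ n + l u ∧ n`. -/
structure IsCurvatureFunction (g : PseudoRiemannianMetric (𝓡 3) M)
    (U V N : Π x : M, TangentSpace (𝓡 3) x) (f : M → ℝ)
    (κ : Π x : M, TangentSpace (𝓡 3) x →L[ℝ] ℝ) (l : M → ℝ) : Prop where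
  smooth : ContMDiff (𝓡 3) 𝓘(ℝ) ∞ l
  extDeriv_eq : ∀ X Y : Π x : M, TangentSpace (𝓡 3) x, IsSmoothField X → IsSmoothField Y → ∀ x,
    extDerivOneForm κ X Y x =
      mvfderiv (𝓡 3) f x (V x)
          * wedge (g.inner x (V x)) (g.inner x (U x)) (X x) (Y x)
        + (mvfderiv (𝓡 3) f x (N x) + f x ^ 2 + κ x (U x) * f x)
          * wedge (g.inner x (V x)) (g.inner x (N x)) (X x) (Y x)
        + l x * wedge (g.inner x (U x)) (g.inner x (N x)) (X x) (Y x)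

end SkewTorsion

end

/-! The metric forces κ: it must be `g(∇V, N)`, and the remaining components of `∇V` and `∇N` follow
by differentiating the constant inner products of the null frame. Torsion-freeness then expresses
the brackets through f and κ: `[U,V] = (κ(U)+f) N`, `[U,N] = -(κ(U)+f) U`, `[V,N] = 2f V - κ(V) U -
κ(N) N`. The Jacobi identity for `U, V, N` has three components (`structure_equations`): `df(U) = 0`
and the values of dκ on `(U,V)` and `(U,N)`. The value `dκ(V,N)` stays free and is the function l.

A skew-adjoint endomorphism is given in a null frame by three numbers, so the curvature consists of
three two-forms (`curvature_u`, `curvature_v`, `curvature_n`). Taking the trace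
(`ricci_null_coframe`) gives `Ric = -(2f² + df(N)) (u⊗v + v⊗u) - 2 (f² + df(N)) n⊗n - df(V) (u⊗n +
n⊗u) - (l - f κ(V)) u⊗u`. Since `g = u⊗v + v⊗u + n⊗n`, proportionality to g means `df(N) = df(V) =
0` and `l = f κ(V)`, with factor `-2f²`. As `df(U) = 0` always holds, f is then constant because M
is connected. -/

noncomputable section

/-! ### Smooth vector fields: differentials, brackets and the commutator of derivations. -/

section VectorFields

variable {E : Type*} [NormedAddCommGroup E] [NormedSpace ℝ E]
  {H : Type*} [TopologicalSpace H] {I : ModelWithCorners ℝ E H}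
  {M : Type*} [TopologicalSpace M] [ChartedSpace H M]

/-- A section of the trivial line bundle is smooth if and only if it is a smooth function. -/
theorem contMDiffAt_trivial_section {φ : M → ℝ} {x : M} :
    ContMDiffAt I (I.prod 𝓘(ℝ)) ∞
      (fun y ↦ Bundle.TotalSpace.mk' ℝ (E := Bundle.Trivial M ℝ) y (φ y)) x ↔
    ContMDiffAt I 𝓘(ℝ) ∞ φ x := by
  rw [Bundle.contMDiffAt_totalSpace]
  exact ⟨fun h ↦ h.2, fun h ↦ ⟨contMDiffAt_id, h⟩⟩

variable [IsManifold I ∞ M]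

/-- The differential of a smooth function is a smooth section of the cotangent bundle. -/
theorem contMDiffAt_mvfderiv {φ : M → ℝ} {x : M} (hφ : ContMDiffAt I 𝓘(ℝ) ∞ φ x) :
    ContMDiffAt I (I.prod 𝓘(ℝ, E →L[ℝ] ℝ)) ∞
      (fun y ↦ Bundle.TotalSpace.mk' (E →L[ℝ] ℝ)
        (E := fun y : M ↦ TangentSpace I y →L[ℝ] Bundle.Trivial M ℝ y) y (mvfderiv I φ y)) x := by
  rw [contMDiffAt_hom_bundle]
  refine ⟨contMDiffAt_id, ?_⟩
  have h := hφ.mfderiv_const (m := ∞) (by simp)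
  refine h.congr_of_eventuallyEq (Filter.Eventually.of_forall fun y ↦ ?_)
  ext v
  simp [inTangentCoordinates, ContinuousLinearMap.inCoordinates, mvfderiv]
  rfl

theorem ContMDiffAt.mvfderiv_apply {φ : M → ℝ} {X : Π x : M, TangentSpace I x} {x : M}
    (hφ : ContMDiffAt I 𝓘(ℝ) ∞ φ x) (hX : ContMDiffAt I I.tangent ∞ (T% X) x) :
    ContMDiffAt I 𝓘(ℝ) ∞ (fun y ↦ mvfderiv I φ y (X y)) x :=
  contMDiffAt_trivial_section.1 ((contMDiffAt_mvfderiv hφ).clm_bundle_apply hX)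

/-- Smoothness at a point yields a neighbourhood only for each finite order of differentiability;
order one suffices here. It allows identities to be differentiated again at `x`. -/
theorem ContMDiffAt.eventually_mdifferentiableAt_section {X : Π x : M, TangentSpace I x} {x : M}
    (hX : ContMDiffAt I I.tangent ∞ (T% X) x) : ∀ᶠ y in nhds x, MDiffAt (T% X) y := by
  have h : ContMDiffAt I I.tangent 1 (T% X) x := hX.of_le (by simp)
  filter_upwards [(contMDiffAt_iff_contMDiffAt_nhds (by simp)).1 h] with y hy
    using hy.mdifferentiableAt (by simp)

theorem ContMDiffAt.eventually_mdifferentiableAt_function {φ : M → ℝ} {x : M}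
    (hφ : ContMDiffAt I 𝓘(ℝ) ∞ φ x) : ∀ᶠ y in nhds x, MDiffAt φ y := by
  have h : ContMDiffAt I 𝓘(ℝ) 1 φ x := hφ.of_le (by simp)
  filter_upwards [(contMDiffAt_iff_contMDiffAt_nhds (by simp)).1 h] with y hy
    using hy.mdifferentiableAt (by simp)

theorem ContMDiffAt.mlieBracket_smooth [CompleteSpace E] {X Y : Π x : M, TangentSpace I x} {x : M}
    (hX : ContMDiffAt I I.tangent ∞ (T% X) x) (hY : ContMDiffAt I I.tangent ∞ (T% Y) x) :
    ContMDiffAt I I.tangent ∞ (T% (mlieBracket I X Y)) x := by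
  have : IsManifold I (((⊤ : ℕ∞) : WithTop ℕ∞) + 1) M := inferInstanceAs (IsManifold I ∞ M)
  have : IsManifold I (minSmoothness ℝ 2) M := by
    rw [minSmoothness_of_isRCLikeNormedField]; infer_instance
  exact ContMDiffAt.mlieBracket_vectorField (m := ⊤) (n := ⊤) hX hY (by simp)

/-- The Jacobi identity for smooth vector fields. -/
theorem mlieBracket_jacobi [CompleteSpace E] {X Y Z : Π x : M, TangentSpace I x} {x : M}
    (hX : ContMDiffAt I I.tangent ∞ (T% X) x) (hY : ContMDiffAt I I.tangent ∞ (T% Y) x)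
    (hZ : ContMDiffAt I I.tangent ∞ (T% Z) x) :
    mlieBracket I X (mlieBracket I Y Z) x =
      mlieBracket I (mlieBracket I X Y) Z x + mlieBracket I Y (mlieBracket I X Z) x := by
  have h3 : minSmoothness ℝ 3 ≤ (∞ : WithTop ℕ∞) := by
    rw [minSmoothness_of_isRCLikeNormedField]; exact ENat.LEInfty.out
  have h2 : minSmoothness ℝ 2 ≤ (∞ : WithTop ℕ∞) := by
    rw [minSmoothness_of_isRCLikeNormedField]; exact ENat.LEInfty.out
  have : IsManifold I (minSmoothness ℝ 3) M := IsManifold.of_le h3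
  exact leibniz_identity_mlieBracket_apply (hX.of_le h2) (hY.of_le h2) (hZ.of_le h2)

/-- A Lie bracket acts on functions as the commutator of derivations. -/
theorem mvfderiv_mlieBracket [CompleteSpace E] {φ : M → ℝ} {X Y : Π x : M, TangentSpace I x} {x : M}
    (hφ : ContMDiffAt I 𝓘(ℝ) ∞ φ x) (hX : ContMDiffAt I I.tangent ∞ (T% X) x)
    (hY : ContMDiffAt I I.tangent ∞ (T% Y) x) :
    mvfderiv I φ x (mlieBracket I X Y x) =
      mvfderiv I (fun y ↦ mvfderiv I φ y (Y y)) x (X x)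
        - mvfderiv I (fun y ↦ mvfderiv I φ y (X y)) x (Y x) := by
  -- The formula is the difference between Jacobi for `X, Y, φZ` and φ times Jacobi for `X, Y, Z`:
  -- the terms with one derivative of φ are symmetric in `X, Y` and cancel, and a multiple of `z`
  -- remains. Comparing coefficients needs `z ≠ 0`, so the zero tangent space is treated separately.
  by_cases h0 : ∀ v : TangentSpace I x, v = 0
  · rw [h0 (mlieBracket I X Y x), h0 (X x), h0 (Y x)]; simp
  push Not at h0
  obtain ⟨z, hz⟩ := h0
  obtain ⟨Z, hZx, hZ⟩ : ∃ Z : Π x : M, TangentSpace I x, Z x = z ∧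
      ContMDiffAt I I.tangent ∞ (T% Z) x :=
    ⟨extend E z, extend_apply_self .., contMDiffAt_extend I E z⟩
  have bracket {Y : Π x : M, TangentSpace I x} :
      mlieBracket I Y (φ • Z) =ᶠ[nhds x]
        (fun y ↦ mvfderiv I φ y (Y y)) • Z + φ • mlieBracket I Y Z := by
    filter_upwards [hφ.eventually_mdifferentiableAt_function,
      hZ.eventually_mdifferentiableAt_section] with y h1 h2 using mlieBracket_smul_right h1 h2
  have double {X Y : Π x : M, TangentSpace I x} (hY : ContMDiffAt I I.tangent ∞ (T% Y) x) :
      mlieBracket I X (mlieBracket I Y (φ • Z)) x =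
        mvfderiv I (fun y ↦ mvfderiv I φ y (Y y)) x (X x) • z
          + mvfderiv I φ x (Y x) • mlieBracket I X Z x
          + (mvfderiv I φ x (X x) • mlieBracket I Y Z x
          + φ x • mlieBracket I X (mlieBracket I Y Z) x) := by
    have d1 := (hφ.mvfderiv_apply hY).mdifferentiableAt (by simp)
    have d2 := hφ.mdifferentiableAt (by simp)
    have d3 := hZ.mdifferentiableAt (by simp)
    have d4 := (hY.mlieBracket_smooth hZ).mdifferentiableAt (by simp)
    rw [Filter.EventuallyEq.mlieBracket_vectorField_eq (Filter.EventuallyEq.refl _ X)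
        (bracket (Y := Y)),
      mlieBracket_add_right (d1.smul_section d3) (d2.smul_section d4),
      mlieBracket_smul_right d1 d3, mlieBracket_smul_right d2 d4, hZx]
  have J := mlieBracket_jacobi hX hY (hφ.smul_section hZ)
  have J' := mlieBracket_jacobi hX hY hZ
  have e : mlieBracket I (mlieBracket I X Y) (φ • Z) x =
      mvfderiv I φ x (mlieBracket I X Y x) • z + φ x • mlieBracket I (mlieBracket I X Y) Z x := by
    rw [mlieBracket_smul_right (hφ.mdifferentiableAt (by simp)) (hZ.mdifferentiableAt (by simp)),
      hZx]
  change mlieBracket I X (mlieBracket I Y (φ • Z)) x = mlieBracket I (mlieBracket I X Y) (φ • Z) x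
    + mlieBracket I Y (mlieBracket I X (φ • Z)) x at J
  rw [double hY, double hX, e, J', ← sub_eq_zero] at J
  refine (smul_left_injective ℝ hz) (?_ : _ • z = _ • z)
  rw [← sub_eq_zero, ← neg_eq_zero, ← J]
  module

end VectorFields

/-! ### Linear algebra of orthonormal and null frames. -/

section NullFrame

variable {M : Type*} [TopologicalSpace M] [ChartedSpace (EuclideanSpace ℝ (Fin 3)) M]

theorem finrank_tangentSpace_three (x : M) : Module.finrank ℝ (TangentSpace (𝓡 3) x) = 3 :=
  finrank_euclideanSpace_fin (𝕜 := ℝ) (n := 3)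

variable [IsManifold (𝓡 3) ∞ M] {g : PseudoRiemannianMetric (𝓡 3) M}

namespace IsLorentzOrthonormal

variable {x : M} {e : Fin 3 → TangentSpace (𝓡 3) x} (he : IsLorentzOrthonormal g x e)
include he

theorem linearIndependent : LinearIndependent ℝ e := by
  rw [Fintype.linearIndependent_iff]
  intro c hc i
  have h : g.inner x (∑ j, c j • e j) (e i) = 0 := by rw [hc]; simp
  simp only [map_sum, map_smul, sum_apply, smul_apply, he _ i] at h
  fin_cases i <;> simpa [Fin.sum_univ_three] using h

theorem expansion (w : TangentSpace (𝓡 3) x) :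
    w = -g.inner x w (e 0) • e 0 + g.inner x w (e 1) • e 1 + g.inner x w (e 2) • e 2 := by
  let b := basisOfLinearIndependentOfCardEqFinrank he.linearIndependent
    (by simp [finrank_tangentSpace_three])
  have hb : ⇑b = e := coe_basisOfLinearIndependentOfCardEqFinrank _ _
  have h := b.sum_repr w
  rw [Fin.sum_univ_three, hb] at h
  generalize b.repr w 0 = p, b.repr w 1 = q, b.repr w 2 = r at h
  rw [← h]
  simp [he _ _]

end IsLorentzOrthonormal

/-- Vectors `u, v, n` with the products of a null frame: `u` and `v` are isotropic, conjugate, and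
orthogonal to the unit vector `n`. -/
structure IsNullTriple (g : PseudoRiemannianMetric (𝓡 3) M) (x : M)
    (u v n : TangentSpace (𝓡 3) x) : Prop where
  uu : g.inner x u u = 0
  vv : g.inner x v v = 0
  uv : g.inner x u v = 1
  un : g.inner x u n = 0
  vn : g.inner x v n = 0
  nn : g.inner x n n = 1

namespace IsNullTriple

variable {x : M} {u v n : TangentSpace (𝓡 3) x} (h : IsNullTriple g x u v n)
include h

theorem vu : g.inner x v u = 1 := by rw [g.symm, h.uv]
theorem nu : g.inner x n u = 0 := by rw [g.symm, h.un]
theorem nv : g.inner x n v = 0 := by rw [g.symm, h.vn]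

theorem linearIndependent : LinearIndependent ℝ ![u, v, n] := by
  rw [Fintype.linearIndependent_iff]
  intro c hc
  have key (z) : g.inner x (∑ j, c j • ![u, v, n] j) z = 0 := by rw [hc]; simp
  simp only [Fin.sum_univ_three, map_add, map_smul, add_apply, smul_apply] at key
  have ku := key u
  have kv := key v
  have kn := key n
  simp [h.uu, h.vv, h.uv, h.un, h.vn, h.nn, h.vu, h.nu, h.nv] at ku kv kn
  intro i
  fin_cases i <;> assumption

/-- The basis of the tangent space formed by a null triple. -/
def basis : Module.Basis (Fin 3) ℝ (TangentSpace (𝓡 3) x) :=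
  basisOfLinearIndependentOfCardEqFinrank h.linearIndependent (by simp [finrank_tangentSpace_three])

theorem coe_basis : ⇑h.basis = ![u, v, n] :=
  coe_basisOfLinearIndependentOfCardEqFinrank _ _

theorem basis_repr (w : TangentSpace (𝓡 3) x) :
    ⇑(h.basis.repr w) = ![g.inner x w v, g.inner x w u, g.inner x w n] := by
  have hw := h.basis.sum_repr w
  rw [Fin.sum_univ_three, h.coe_basis] at hw
  ext i
  generalize e0 : h.basis.repr w 0 = p, e1 : h.basis.repr w 1 = q, e2 : h.basis.repr w 2 = r at hw
  conv_rhs => rw [← hw]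
  fin_cases i <;>
    simp [e0, e1, e2, h.uu, h.vv, h.uv, h.un, h.vn, h.nn, h.vu, h.nu, h.nv]

theorem expansion (w : TangentSpace (𝓡 3) x) :
    w = g.inner x w v • u + g.inner x w u • v + g.inner x w n • n := by
  have hw := h.basis.sum_repr w
  rw [Fin.sum_univ_three, h.coe_basis, h.basis_repr] at hw
  simpa using hw.symm

theorem inner_eq (w z : TangentSpace (𝓡 3) x) : g.inner x w z =
    g.inner x w v * g.inner x z u + g.inner x w u * g.inner x z v
      + g.inner x w n * g.inner x z n := by
  conv_lhs => rw [h.expansion w]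
  simp [g.symm x _ z]

/-- Contraction of an alternating three-form with the first vector of a null triple. -/
theorem alternating_apply (τ : TangentSpace (𝓡 3) x [⋀^Fin 3]→ₗ[ℝ] ℝ)
    (a b : TangentSpace (𝓡 3) x) : τ ![u, a, b] =
      τ ![u, v, n] * (g.inner x a u * g.inner x b n - g.inner x b u * g.inner x a n) := by
  have hτ := congr($(τ.eq_smul_basis_det h.basis) ![u, a, b])
  rw [h.coe_basis] at hτ
  rw [hτ]
  simp [Module.Basis.det_apply, Matrix.det_fin_three, Module.Basis.toMatrix_apply, h.basis_repr,
    h.uu, h.uv, h.un]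

/-- The trace of an endomorphism, computed in a null triple. -/
theorem trace_eq (L : TangentSpace (𝓡 3) x →ₗ[ℝ] TangentSpace (𝓡 3) x) :
    LinearMap.trace ℝ _ L =
      g.inner x (L u) v + g.inner x (L v) u + g.inner x (L n) n := by
  rw [LinearMap.trace_eq_matrix_trace ℝ h.basis, Matrix.trace, Fin.sum_univ_three]
  simp [LinearMap.toMatrix_apply, h.basis_repr, h.coe_basis]

end IsNullTriple

/-- The square of the volume of three vectors is minus their Gram determinant. -/
theorem sq_volume_eq_neg_det_gram {x : M} {τ : TangentSpace (𝓡 3) x [⋀^Fin 3]→ₗ[ℝ] ℝ}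
    {e : Fin 3 → TangentSpace (𝓡 3) x} (he : IsLorentzOrthonormal g x e)
    (hτ : τ e = 1 ∨ τ e = -1) (w : Fin 3 → TangentSpace (𝓡 3) x) :
    τ w ^ 2 = -(Matrix.of fun i j ↦ g.inner x (w i) (w j)).det := by
  let b := basisOfLinearIndependentOfCardEqFinrank he.linearIndependent
    (by simp [finrank_tangentSpace_three])
  have hb : ⇑b = e := coe_basisOfLinearIndependentOfCardEqFinrank _ _
  have h1 : τ w = τ e * (b.toMatrix w).det := by
    have := congr($(τ.eq_smul_basis_det b) w)
    rw [hb] at this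
    rw [this]
    simp [Module.Basis.det_apply]
  -- The Gram matrix is `Bᵀ η B` with `η = diag(-1, 1, 1)`; the sign of the result is `det η = -1`.
  have h2 : (Matrix.of fun i j ↦ g.inner x (w i) (w j)) =
      (b.toMatrix w).transpose * Matrix.diagonal ![-1, 1, 1] * b.toMatrix w := by
    ext i j
    have hi := b.sum_repr (w i)
    have hj := b.sum_repr (w j)
    rw [Fin.sum_univ_three, hb] at hi hj
    simp only [Matrix.of_apply, Matrix.mul_apply, Fin.sum_univ_three,
      Matrix.transpose_apply, Module.Basis.toMatrix_apply]
    conv_lhs => rw [← hi, ← hj]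
    simp [he _ _]
  have h3 : τ e ^ 2 = 1 := by rcases hτ with h | h <;> rw [h] <;> norm_num
  rw [h2, Matrix.det_mul, Matrix.det_mul, Matrix.det_transpose, Matrix.det_diagonal, h1,
    mul_pow, h3]
  simp [Fin.prod_univ_three]
  ring

variable {ν : Π x : M, TangentSpace (𝓡 3) x [⋀^Fin 3]→ₗ[ℝ] ℝ}
  {U V N : Π x : M, TangentSpace (𝓡 3) x} {f : M → ℝ}

/-- Orthogonality of `N` to `U` and `V` holds because ν is alternating. That `N` is a unit vector
comes from the normalisation of ν on orthonormal frames, through Gram determinants. -/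
theorem IsSkewTorsion.isNullTriple (hM : IsSkewTorsion g ν U f) (hc : IsNullCoframe g ν U V N)
    (x : M) : IsNullTriple g x (U x) (V x) (N x) := by
  have hNU : g.inner x (N x) (U x) = 0 := by
    rw [hc.screen, hodgeStarTwo, (ν x).map_eq_zero_of_eq _ (i := 0) (j := 2) rfl (by decide)]
    simp
  have hNV : g.inner x (N x) (V x) = 0 := by
    rw [hc.screen, hodgeStarTwo, (ν x).map_eq_zero_of_eq _ (i := 1) (j := 2) rfl (by decide)]
    simp
  obtain ⟨e, he⟩ := hM.lorentzian x
  have gram (w : TangentSpace (𝓡 3) x) : g.inner x (N x) w ^ 2 =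
      g.inner x w w - 2 * g.inner x (U x) w * g.inner x (V x) w := by
    have h := sq_volume_eq_neg_det_gram he (hM.volume.unit x e he) ![U x, V x, w]
    rw [hc.screen, hodgeStarTwo, neg_sq, h, Matrix.det_fin_three]
    simp [hM.isotropic, hc.isotropic, hc.conjugate, g.symm x (V x) (U x), g.symm x w (U x),
      g.symm x w (V x)]
    ring
  have inner_self (w z : TangentSpace (𝓡 3) x) : g.inner x w z =
      -(g.inner x w (e 0) * g.inner x z (e 0)) + g.inner x w (e 1) * g.inner x z (e 1)
        + g.inner x w (e 2) * g.inner x z (e 2) := by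
    conv_lhs => rw [he.expansion w]
    simp [g.symm x _ z]
  -- Summing `gram` over the orthonormal frame with signs `ε_i` gives `g(N,N) = ∑ ε_i g(e_i,e_i) - 2
  -- g(U,V) = 3 - 2 = 1`.
  have hNN : g.inner x (N x) (N x) = 1 := by
    have hUV := hc.conjugate x
    rw [inner_self] at hUV
    rw [inner_self, ← sq, ← sq, ← sq, gram, gram, gram, he, he, he]
    simp
    linarith
  exact ⟨hM.isotropic x, hc.isotropic x, hc.conjugate x, by rw [g.symm, hNU], by rw [g.symm, hNV],
    hNN⟩

end NullFrame

/-! ### General formulas for the Levi-Civita connection, exterior derivatives and curvature. -/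

section Curvature

variable {E : Type*} [NormedAddCommGroup E] [NormedSpace ℝ E]
  {H : Type*} [TopologicalSpace H] {I : ModelWithCorners ℝ E H}
  {M : Type*} [TopologicalSpace M] [ChartedSpace H M]

theorem Filter.EventuallyEq.mvfderiv_eq {φ ψ : M → ℝ} {x : M} (h : φ =ᶠ[nhds x] ψ) :
    mvfderiv I φ x = mvfderiv I ψ x := by
  ext v
  simp only [mvfderiv, ContinuousLinearMap.comp_apply, h.mfderiv_eq]
  rfl

variable [IsManifold I ∞ M] {x : M}

/-- The exterior derivative of a one-form is tensorial. -/
theorem exists_extDerivOneForm_eq_bilinear [FiniteDimensional ℝ E]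
    {α : Π x : M, TangentSpace I x →L[ℝ] ℝ}
    (hα : ∀ X : Π x : M, TangentSpace I x, MDiffAt (T% X) x → MDiffAt (fun y ↦ α y (X y)) x) :
    ∃ B : TangentSpace I x →L[ℝ] TangentSpace I x →L[ℝ] ℝ,
      ∀ X Y : Π x : M, TangentSpace I x, MDiffAt (T% X) x → MDiffAt (T% Y) x →
        extDerivOneForm α X Y x = B (X x) (Y x) := by
  have : CompleteSpace E := FiniteDimensional.complete ℝ E
  have t1 (Y : Π x : M, TangentSpace I x) (hY : MDiffAt (T% Y) x) :
      TensorialAt I E (fun X ↦ extDerivOneForm α X Y x) x :=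
    { smul := fun {f X} hf hX ↦ by
        have h1 := mvfderiv_fun_mul hf (hα X hX)
        simp [extDerivOneForm, mlieBracket_smul_left hf hX, h1]
        ring
      add := fun {X X'} hX hX' ↦ by
        have h1 := mvfderiv_fun_add (hα X hX) (hα X' hX')
        simp [extDerivOneForm, mlieBracket_add_left hX hX', h1]
        ring }
  have t2 (Y : Π x : M, TangentSpace I x) (hY : MDiffAt (T% Y) x) :
      TensorialAt I E (fun X ↦ extDerivOneForm α Y X x) x :=
    { smul := fun {f X} hf hX ↦ by
        have h1 := mvfderiv_fun_mul hf (hα X hX)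
        simp [extDerivOneForm, mlieBracket_smul_right hf hX, h1]
        ring
      add := fun {X X'} hX hX' ↦ by
        have h1 := mvfderiv_fun_add (hα X hX) (hα X' hX')
        simp [extDerivOneForm, mlieBracket_add_right hX hX', h1]
        ring }
  exact ⟨TensorialAt.mkHom₂ (fun X Y ↦ extDerivOneForm α X Y x) x t1 t2,
    fun X Y hX hY ↦ (TensorialAt.mkHom₂_apply t1 t2 hX hY).symm⟩

namespace PseudoRiemannianMetric

variable (g : PseudoRiemannianMetric I M)

theorem contMDiffAt_inner {X Y : Π x : M, TangentSpace I x}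
    (hX : ContMDiffAt I I.tangent ∞ (T% X) x) (hY : ContMDiffAt I I.tangent ∞ (T% Y) x) :
    ContMDiffAt I 𝓘(ℝ) ∞ (fun y ↦ g.inner y (X y) (Y y)) x := by
  refine contMDiffAt_trivial_section.1 ?_
  apply ContMDiffAt.clm_bundle_apply₂ (F₁ := E) (F₂ := E)
  · exact g.contMDiff x
  · exact hX
  · exact hY

variable [FiniteDimensional ℝ E]

theorem leviCivita_add {X Y : Π x : M, TangentSpace I x} (hX : MDiffAt (T% X) x)
    (hY : MDiffAt (T% Y) x) (w : TangentSpace I x) :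
    g.leviCivita (X + Y) x w = g.leviCivita X x w + g.leviCivita Y x w := by
  rw [g.leviCivita.isCovariantDerivativeOnUniv.add hX hY]; rfl

theorem leviCivita_smul {φ : M → ℝ} {X : Π x : M, TangentSpace I x} (hφ : MDiffAt φ x)
    (hX : MDiffAt (T% X) x) (w : TangentSpace I x) :
    g.leviCivita (φ • X) x w = φ x • g.leviCivita X x w + mvfderiv I φ x w • X x := by
  rw [g.leviCivita.isCovariantDerivativeOnUniv.leibniz hX hφ]; rfl

/-- Compatibility with the metric, in the direction of a tangent vector. -/
theorem mvfderiv_inner {Y Z : Π x : M, TangentSpace I x} (hY : MDiffAt (T% Y) x)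
    (hZ : MDiffAt (T% Z) x) (w : TangentSpace I x) :
    mvfderiv I (fun y ↦ g.inner y (Y y) (Z y)) x w =
      g.inner x (g.leviCivita Y x w) (Z x) + g.inner x (Y x) (g.leviCivita Z x w) := by
  have h := g.leviCivita_metric (mdifferentiableAt_extend I E w) hY hZ
  rwa [extend_apply_self] at h

/-- Fields with constant inner product. -/
theorem inner_leviCivita_add_eq_zero {Y Z : Π x : M, TangentSpace I x} (hY : MDiffAt (T% Y) x)
    (hZ : MDiffAt (T% Z) x) {c : ℝ} (h : ∀ y, g.inner y (Y y) (Z y) = c) (w : TangentSpace I x) :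
    g.inner x (g.leviCivita Y x w) (Z x) + g.inner x (Y x) (g.leviCivita Z x w) = 0 := by
  rw [← g.mvfderiv_inner hY hZ, funext h, mvfderiv_const]; rfl

/-- The exterior derivative of a multiple of the metric dual of a field. -/
theorem extDerivOneForm_smul_flat {φ : M → ℝ} {P X Y : Π x : M, TangentSpace I x}
    (hφ : MDiffAt φ x) (hP : MDiffAt (T% P) x) (hX : MDiffAt (T% X) x) (hY : MDiffAt (T% Y) x) :
    extDerivOneForm (fun y ↦ φ y • g.inner y (P y)) X Y x =
      wedge (mvfderiv I φ x) (g.inner x (P x)) (X x) (Y x)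
        + φ x * (g.inner x (g.leviCivita P x (X x)) (Y x)
          - g.inner x (g.leviCivita P x (Y x)) (X x)) := by
  have h1 := mvfderiv_fun_mul hφ (g.mdifferentiableAt_inner hP hX)
  have h2 := mvfderiv_fun_mul hφ (g.mdifferentiableAt_inner hP hY)
  simp only [extDerivOneForm, smul_apply, smul_eq_mul, h1, h2, add_apply,
    g.mvfderiv_inner hP hX, g.mvfderiv_inner hP hY, ← g.leviCivita_torsion_free hX hY, wedge,
    map_sub]
  ring

/-- The curvature on a field with covariant derivative `α ⊗ P + β ⊗ Q`. -/
theorem curvature_eq_of_leviCivita_eq {W P Q X Y : Π x : M, TangentSpace I x}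
    {α β : Π x : M, TangentSpace I x →L[ℝ] ℝ}
    (hW : ∀ y w, g.leviCivita W y w = α y w • P y + β y w • Q y)
    (hP : MDiffAt (T% P) x) (hQ : MDiffAt (T% Q) x)
    (hα : ∀ X : Π x : M, TangentSpace I x, MDiffAt (T% X) x → MDiffAt (fun y ↦ α y (X y)) x)
    (hβ : ∀ X : Π x : M, TangentSpace I x, MDiffAt (T% X) x → MDiffAt (fun y ↦ β y (X y)) x)
    (hX : MDiffAt (T% X) x) (hY : MDiffAt (T% Y) x) :
    g.curvature X Y W x = extDerivOneForm α X Y x • P x + extDerivOneForm β X Y x • Q x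
      + α x (Y x) • g.leviCivita P x (X x) - α x (X x) • g.leviCivita P x (Y x)
      + β x (Y x) • g.leviCivita Q x (X x) - β x (X x) • g.leviCivita Q x (Y x) := by
  have key (Z : Π x : M, TangentSpace I x) (hZ : MDiffAt (T% Z) x) (w : TangentSpace I x) :
      g.leviCivita (fun y ↦ g.leviCivita W y (Z y)) x w =
        α x (Z x) • g.leviCivita P x w + mvfderiv I (fun y ↦ α y (Z y)) x w • P x
        + (β x (Z x) • g.leviCivita Q x w + mvfderiv I (fun y ↦ β y (Z y)) x w • Q x) := by
    have e : (fun y ↦ g.leviCivita W y (Z y)) =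
        (fun y ↦ α y (Z y)) • P + (fun y ↦ β y (Z y)) • Q := funext fun y ↦ hW y (Z y)
    rw [e, g.leviCivita_add ((hα Z hZ).smul_section hP) ((hβ Z hZ).smul_section hQ),
      g.leviCivita_smul (hα Z hZ) hP, g.leviCivita_smul (hβ Z hZ) hQ]
  -- The term `-∇_[X,Y] W` supplies exactly the bracket terms of dα and dβ.
  rw [curvature, key Y hY, key X hX, hW, extDerivOneForm, extDerivOneForm]
  module

/-- The curvature endomorphisms are skew-adjoint. -/
theorem inner_curvature_skew {X Y Z W : Π x : M, TangentSpace I x}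
    (hX : ContMDiffAt I I.tangent ∞ (T% X) x) (hY : ContMDiffAt I I.tangent ∞ (T% Y) x)
    (hZ : ContMDiffAt I I.tangent ∞ (T% Z) x) (hW : ContMDiffAt I I.tangent ∞ (T% W) x)
    (hXZ : MDiffAt (T% (fun y ↦ g.leviCivita Z y (X y))) x)
    (hYZ : MDiffAt (T% (fun y ↦ g.leviCivita Z y (Y y))) x)
    (hXW : MDiffAt (T% (fun y ↦ g.leviCivita W y (X y))) x)
    (hYW : MDiffAt (T% (fun y ↦ g.leviCivita W y (Y y))) x) :
    g.inner x (g.curvature X Y Z x) (W x) = -g.inner x (Z x) (g.curvature X Y W x) := by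
  have : CompleteSpace E := FiniteDimensional.complete ℝ E
  have dZ := hZ.mdifferentiableAt (by simp)
  have dW := hW.mdifferentiableAt (by simp)
  -- Second derivatives of the function `g(Z, W)`. Antisymmetrised in `X, Y` they give its
  -- derivative along `[X,Y]`; the terms with one derivative on each of `Z` and `W` are symmetric
  -- and drop out.
  have second (A : Π x : M, TangentSpace I x)
      (hAZ : MDiffAt (T% (fun y ↦ g.leviCivita Z y (A y))) x)
      (hAW : MDiffAt (T% (fun y ↦ g.leviCivita W y (A y))) x) (w : TangentSpace I x) :
      mvfderiv I (fun y ↦ mvfderiv I (fun y ↦ g.inner y (Z y) (W y)) y (A y)) x w =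
        g.inner x (g.leviCivita (fun y ↦ g.leviCivita Z y (A y)) x w) (W x)
          + g.inner x (g.leviCivita Z x (A x)) (g.leviCivita W x w)
          + (g.inner x (g.leviCivita Z x w) (g.leviCivita W x (A x))
          + g.inner x (Z x) (g.leviCivita (fun y ↦ g.leviCivita W y (A y)) x w)) := by
    have e : (fun y ↦ mvfderiv I (fun y ↦ g.inner y (Z y) (W y)) y (A y)) =ᶠ[nhds x]
        fun y ↦ g.inner y (g.leviCivita Z y (A y)) (W y)
          + g.inner y (Z y) (g.leviCivita W y (A y)) := by
      filter_upwards [hZ.eventually_mdifferentiableAt_section,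
        hW.eventually_mdifferentiableAt_section] with y h1 h2 using g.mvfderiv_inner h1 h2 _
    rw [e.mvfderiv_eq, mvfderiv_fun_add (g.mdifferentiableAt_inner hAZ dW)
      (g.mdifferentiableAt_inner dZ hAW), add_apply, g.mvfderiv_inner hAZ dW,
      g.mvfderiv_inner dZ hAW]
  have h := mvfderiv_mlieBracket (g.contMDiffAt_inner hZ hW) hX hY
  rw [second Y hYZ hYW, second X hXZ hXW, g.mvfderiv_inner dZ dW] at h
  simp only [curvature, map_sub, sub_apply]
  linarith

end PseudoRiemannianMetric

end Curvature

/-! ### Smoothness of the Levi-Civita connection. -/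

section LeviCivitaSmooth

variable {E : Type*} [NormedAddCommGroup E] [NormedSpace ℝ E]
  {H : Type*} [TopologicalSpace H] {I : ModelWithCorners ℝ E H}
  {M : Type*} [TopologicalSpace M] [ChartedSpace H M] [IsManifold I ∞ M] {x : M}

namespace PseudoRiemannianMetric

variable (g : PseudoRiemannianMetric I M)

theorem contMDiffAt_flat {X : Π x : M, TangentSpace I x}
    (hX : ContMDiffAt I I.tangent ∞ (T% X) x) :
    ContMDiffAt I (I.prod 𝓘(ℝ, E →L[ℝ] ℝ)) ∞
      (fun y ↦ Bundle.TotalSpace.mk' (E →L[ℝ] ℝ)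
        (E := fun y : M ↦ TangentSpace I y →L[ℝ] ℝ) y (g.inner y (X y))) x :=
  ContMDiffAt.clm_bundle_apply (F₁ := E) (F₂ := E →L[ℝ] ℝ)
    (E₂ := fun y : M ↦ TangentSpace I y →L[ℝ] Bundle.Trivial M ℝ y) (g.contMDiff x) hX

theorem contMDiffAt_koszul [CompleteSpace E] {X Y Z : Π x : M, TangentSpace I x}
    (hX : ContMDiffAt I I.tangent ∞ (T% X) x) (hY : ContMDiffAt I I.tangent ∞ (T% Y) x)
    (hZ : ContMDiffAt I I.tangent ∞ (T% Z) x) : ContMDiffAt I 𝓘(ℝ) ∞ (g.koszul X Y Z) x :=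
  ((((((g.contMDiffAt_inner hY hZ).mvfderiv_apply hX).add
    ((g.contMDiffAt_inner hX hZ).mvfderiv_apply hY)).sub
    ((g.contMDiffAt_inner hX hY).mvfderiv_apply hZ)).add
    (g.contMDiffAt_inner (hX.mlieBracket_smooth hY) hZ)).sub
    (g.contMDiffAt_inner (hX.mlieBracket_smooth hZ) hY)).sub
    (g.contMDiffAt_inner (hY.mlieBracket_smooth hZ) hX)

/-- The covariant derivative is defined pointwise by inverting the metric, so its regularity is
visible only in its pairings, which Koszul's formula expresses by smooth functions near `x`. -/
theorem contMDiffAt_inner_leviCivita [FiniteDimensional ℝ E] {X Y Z : Π x : M, TangentSpace I x}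
    (hX : ContMDiffAt I I.tangent ∞ (T% X) x) (hY : ContMDiffAt I I.tangent ∞ (T% Y) x)
    (hZ : ContMDiffAt I I.tangent ∞ (T% Z) x) :
    ContMDiffAt I 𝓘(ℝ) ∞ (fun y ↦ g.inner y (g.leviCivita Y y (X y)) (Z y)) x := by
  have : CompleteSpace E := FiniteDimensional.complete ℝ E
  refine ((contMDiffAt_const (c := (1 / 2 : ℝ))).mul
    (g.contMDiffAt_koszul hX hY hZ)).congr_of_eventuallyEq ?_
  filter_upwards [hX.eventually_mdifferentiableAt_section,
    hY.eventually_mdifferentiableAt_section, hZ.eventually_mdifferentiableAt_section]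
    with y h1 h2 h3 using g.inner_leviCivitaFun_eq_koszul h1 h2 h3

end PseudoRiemannianMetric

end LeviCivitaSmooth

/-! ### Null coframes and existence of the connection form. -/

section NullCoframe

variable {M : Type*} [TopologicalSpace M] [ChartedSpace (EuclideanSpace ℝ (Fin 3)) M]
  [IsManifold (𝓡 3) ∞ M] {g : PseudoRiemannianMetric (𝓡 3) M}
  {ν : Π x : M, TangentSpace (𝓡 3) x [⋀^Fin 3]→ₗ[ℝ] ℝ}
  {U V N : Π x : M, TangentSpace (𝓡 3) x} {f l : M → ℝ}
  {κ : Π x : M, TangentSpace (𝓡 3) x →L[ℝ] ℝ} {x : M}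

theorem IsSmoothField.mdifferentiableAt {X : Π x : M, TangentSpace (𝓡 3) x}
    (hX : IsSmoothField X) (x : M) :
    MDifferentiableAt (𝓡 3) (𝓡 3).tangent (T% X) x :=
  (hX x).mdifferentiableAt (by simp)

/-- Smoothness of a field can be tested on its coefficients in a null frame. -/
theorem contMDiffAt_of_inner_null_frame (hU : IsSmoothField U) (hV : IsSmoothField V)
    (hN : IsSmoothField N) (h : ∀ x, IsNullTriple g x (U x) (V x) (N x))
    {T : Π x : M, TangentSpace (𝓡 3) x}
    (hTU : ContMDiffAt (𝓡 3) 𝓘(ℝ) ∞ (fun y ↦ g.inner y (T y) (U y)) x)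
    (hTV : ContMDiffAt (𝓡 3) 𝓘(ℝ) ∞ (fun y ↦ g.inner y (T y) (V y)) x)
    (hTN : ContMDiffAt (𝓡 3) 𝓘(ℝ) ∞ (fun y ↦ g.inner y (T y) (N y)) x) :
    ContMDiffAt (𝓡 3) (𝓡 3).tangent ∞ (T% T) x := by
  rw [funext fun y ↦ (h y).expansion (T y)]
  exact ((hTV.smul_section (hU x)).add_section (hTU.smul_section (hV x))).add_section
    (hTN.smul_section (hN x))

/-- Covariant derivatives of smooth fields are smooth. -/
theorem contMDiffAt_leviCivita_null_frame (hU : IsSmoothField U) (hV : IsSmoothField V)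
    (hN : IsSmoothField N) (h : ∀ x, IsNullTriple g x (U x) (V x) (N x))
    {X Y : Π x : M, TangentSpace (𝓡 3) x} (hX : ContMDiffAt (𝓡 3) (𝓡 3).tangent ∞ (T% X) x)
    (hY : ContMDiffAt (𝓡 3) (𝓡 3).tangent ∞ (T% Y) x) :
    ContMDiffAt (𝓡 3) (𝓡 3).tangent ∞ (T% (fun y ↦ g.leviCivita Y y (X y))) x :=
  contMDiffAt_of_inner_null_frame hU hV hN h (g.contMDiffAt_inner_leviCivita hX hY (hU x))
    (g.contMDiffAt_inner_leviCivita hX hY (hV x)) (g.contMDiffAt_inner_leviCivita hX hY (hN x))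

/-- The sign in `n = -∗(u ∧ v)` makes the frame negatively oriented; this sign decides that of `∇u`.
-/
theorem IsSkewTorsion.volume_frame (hM : IsSkewTorsion g ν U f) (hc : IsNullCoframe g ν U V N)
    (x : M) : ν x ![U x, V x, N x] = -1 := by
  have h := hc.screen x (N x)
  rw [(hM.isNullTriple hc x).nn, hodgeStarTwo] at h
  linarith

/-- Contracting ν with `U`, when `ν(U,V,N) = -1`, gives `∗u = n ∧ u`. -/
theorem IsSkewTorsion.nabla_u (hM : IsSkewTorsion g ν U f) (hc : IsNullCoframe g ν U V N)
    (x : M) (w : TangentSpace (𝓡 3) x) :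
    g.leviCivita U x w = (f x * g.inner x (N x) w) • U x - (f x * g.inner x (U x) w) • N x := by
  refine g.ext_inner fun z ↦ ?_
  rw [hM.parallel, hodgeStarOne, (hM.isNullTriple hc x).alternating_apply,
    hM.volume_frame hc]
  simp [g.symm x w, g.symm x z]
  ring

/-- The connection form of a null coframe. -/
theorem IsSkewTorsion.exists_isConnectionForm (hM : IsSkewTorsion g ν U f)
    (hc : IsNullCoframe g ν U V N) : ∃ κ, IsConnectionForm g U V N f κ := by
  have h := hM.isNullTriple hc
  have dU := hM.smooth.mdifferentiableAt
  have dV := hc.smooth_v.mdifferentiableAt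
  have dN := hc.smooth_n.mdifferentiableAt
  -- The only possible choice: pairing the required formula for `∇V` with `N` leaves κ.
  let κ : Π x : M, TangentSpace (𝓡 3) x →L[ℝ] ℝ :=
    fun x ↦ (g.inner x (N x)).comp (g.leviCivita V x)
  have hκ (x : M) (w : TangentSpace (𝓡 3) x) :
      κ x w = g.inner x (N x) (g.leviCivita V x w) := rfl
  -- In this coframe expansion, smoothness of κ as a section reduces to that of three functions.
  have e (x : M) : κ x = κ x (U x) • g.inner x (V x) + κ x (V x) • g.inner x (U x)
      + κ x (N x) • g.inner x (N x) := by
    ext w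
    conv_lhs => rw [(h x).expansion w]
    simp [g.symm x w]
    ring
  have smooth (X : Π x : M, TangentSpace (𝓡 3) x) (hX : IsSmoothField X) (x : M) :
      ContMDiffAt (𝓡 3) 𝓘(ℝ) ∞ (fun y ↦ κ y (X y)) x := by
    simp only [hκ, fun y ↦ g.symm y (N y)]
    exact g.contMDiffAt_inner_leviCivita (hX x) (hc.smooth_v x) (hc.smooth_n x)
  refine ⟨κ, fun x ↦ ?_, hM.nabla_u hc, fun x w ↦ ?_, fun x w ↦ ?_⟩
  · rw [funext e]
    exact (((smooth U hM.smooth x).smul_section (g.contMDiffAt_flat (hc.smooth_v x))).add_section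
      ((smooth V hc.smooth_v x).smul_section (g.contMDiffAt_flat (hM.smooth x)))).add_section
      ((smooth N hc.smooth_n x).smul_section (g.contMDiffAt_flat (hc.smooth_n x)))
  · have h1 := g.inner_leviCivita_add_eq_zero (dV x) (dV x) (fun y ↦ (h y).vv) w
    have h2 := g.inner_leviCivita_add_eq_zero (dV x) (dU x) (fun y ↦ (h y).vu) w
    rw [g.symm x (V x)] at h1
    rw [hM.nabla_u hc] at h2
    simp [(h x).vu, (h x).vn] at h2
    rw [(h x).expansion (g.leviCivita V x w), hκ, g.symm x (N x) (g.leviCivita V x w),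
      show g.inner x (g.leviCivita V x w) (V x) = 0 by linarith,
      show g.inner x (g.leviCivita V x w) (U x) = -(f x * g.inner x (N x) w) by linarith]
    module
  · have h1 := g.inner_leviCivita_add_eq_zero (dN x) (dN x) (fun y ↦ (h y).nn) w
    have h2 := g.inner_leviCivita_add_eq_zero (dN x) (dU x) (fun y ↦ (h y).nu) w
    have h3 := g.inner_leviCivita_add_eq_zero (dN x) (dV x) (fun y ↦ (h y).nv) w
    rw [g.symm x (N x)] at h1
    rw [hM.nabla_u hc] at h2
    simp [(h x).nu, (h x).nn] at h2
    rw [(h x).expansion (g.leviCivita N x w), hκ,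
      show g.inner x (g.leviCivita N x w) (N x) = 0 by linarith,
      show g.inner x (g.leviCivita N x w) (U x) = f x * g.inner x (U x) w by linarith,
      show g.inner x (g.leviCivita N x w) (V x) = -g.inner x (N x) (g.leviCivita V x w) by linarith]
    module

end NullCoframe

/-! ### Structure equations, dκ and the curvature in a null frame. -/

section ConnectionForm

variable {M : Type*} [TopologicalSpace M] [ChartedSpace (EuclideanSpace ℝ (Fin 3)) M]
  [IsManifold (𝓡 3) ∞ M] {g : PseudoRiemannianMetric (𝓡 3) M}
  {ν : Π x : M, TangentSpace (𝓡 3) x [⋀^Fin 3]→ₗ[ℝ] ℝ}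
  {U V N : Π x : M, TangentSpace (𝓡 3) x} {f l : M → ℝ}
  {κ : Π x : M, TangentSpace (𝓡 3) x →L[ℝ] ℝ} {x : M}

theorem IsConnectionForm.contMDiffAt_apply (hκ : IsConnectionForm g U V N f κ)
    {X : Π x : M, TangentSpace (𝓡 3) x} (hX : ContMDiffAt (𝓡 3) (𝓡 3).tangent ∞ (T% X) x) :
    ContMDiffAt (𝓡 3) 𝓘(ℝ) ∞ (fun y ↦ κ y (X y)) x :=
  contMDiffAt_trivial_section.1 (ContMDiffAt.clm_bundle_apply (F₁ := EuclideanSpace ℝ (Fin 3))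
    (F₂ := ℝ) (E₂ := fun y ↦ Bundle.Trivial M ℝ y) (hκ.smooth x) hX)

theorem IsConnectionForm.mdifferentiableAt_apply (hκ : IsConnectionForm g U V N f κ)
    {X : Π x : M, TangentSpace (𝓡 3) x}
    (hX : MDifferentiableAt (𝓡 3) (𝓡 3).tangent (T% X) x) :
    MDifferentiableAt (𝓡 3) 𝓘(ℝ) (fun y ↦ κ y (X y)) x := by
  have h := MDifferentiableAt.clm_bundle_apply (F₁ := EuclideanSpace ℝ (Fin 3))
    (F₂ := ℝ) (E₂ := fun y ↦ Bundle.Trivial M ℝ y) ((hκ.smooth x).mdifferentiableAt (by simp)) hX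
  simp only [mdifferentiableAt_totalSpace] at h
  exact h.2

/-- On `(V, N)` the forms `v ∧ u` and `v ∧ n` vanish and `u ∧ n` is 1. Hence l is determined by κ,
and the Einstein criterion for an arbitrary l reduces to one about `dκ(V,N)`. -/
theorem IsCurvatureFunction.eq_extDerivOneForm (hM : IsSkewTorsion g ν U f)
    (hc : IsNullCoframe g ν U V N) (hl : IsCurvatureFunction g U V N f κ l) (x : M) :
    l x = extDerivOneForm κ V N x := by
  have h := hM.isNullTriple hc x
  rw [hl.extDeriv_eq V N hc.smooth_v hc.smooth_n]
  simp [wedge, h.uv, h.vn, h.vv, h.nn, h.un]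

theorem connectionForm_eq (hM : IsSkewTorsion g ν U f) (hc : IsNullCoframe g ν U V N)
    (w : TangentSpace (𝓡 3) x) : κ x w = κ x (U x) * g.inner x (V x) w
      + κ x (V x) * g.inner x (U x) w + κ x (N x) * g.inner x (N x) w := by
  conv_lhs => rw [(hM.isNullTriple hc x).expansion w]
  simp [g.symm x w]
  ring

variable (hM : IsSkewTorsion g ν U f) (hc : IsNullCoframe g ν U V N)
  (hκ : IsConnectionForm g U V N f κ)
include hM hc hκ

/-- This bracket and the next two are identities of fields, not only at a point, since the Jacobi
identity differentiates their coefficients. -/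
theorem mlieBracket_u_v : mlieBracket (𝓡 3) U V = (fun y ↦ κ y (U y) + f y) • N := by
  funext y
  have h := hM.isNullTriple hc y
  rw [← g.leviCivita_torsion_free (hM.smooth.mdifferentiableAt y)
    (hc.smooth_v.mdifferentiableAt y), hκ.nabla_u, hκ.nabla_v]
  simp only [h.nu, h.nv, h.uv, Pi.smul_apply']
  module

theorem mlieBracket_u_n : mlieBracket (𝓡 3) U N = (fun y ↦ -(κ y (U y) + f y)) • U := by
  funext y
  have h := hM.isNullTriple hc y
  rw [← g.leviCivita_torsion_free (hM.smooth.mdifferentiableAt y)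
    (hc.smooth_n.mdifferentiableAt y), hκ.nabla_u, hκ.nabla_n]
  simp only [h.nn, h.un, h.uu, Pi.smul_apply']
  module

theorem mlieBracket_v_n : mlieBracket (𝓡 3) V N =
    (fun y ↦ f y + f y) • V + ((fun y ↦ -κ y (V y)) • U + (fun y ↦ -κ y (N y)) • N) := by
  funext y
  have h := hM.isNullTriple hc y
  rw [← g.leviCivita_torsion_free (hc.smooth_v.mdifferentiableAt y)
    (hc.smooth_n.mdifferentiableAt y), hκ.nabla_v, hκ.nabla_n]
  simp only [h.nn, h.uv, Pi.smul_apply', Pi.add_apply]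
  module

/-- The structure equations: the consequences of the Jacobi identity for a null frame. -/
theorem structure_equations (x : M) :
    mvfderiv (𝓡 3) f x (U x) = 0 ∧
    extDerivOneForm κ U V x = mvfderiv (𝓡 3) f x (V x) ∧
    extDerivOneForm κ U N x =
      mvfderiv (𝓡 3) f x (N x) + f x ^ 2 + κ x (U x) * f x := by
  have h := hM.isNullTriple hc x
  have dU := hM.smooth.mdifferentiableAt x
  have dV := hc.smooth_v.mdifferentiableAt x
  have dN := hc.smooth_n.mdifferentiableAt x
  have df := (hM.smooth_function x).mdifferentiableAt (by simp)
  have da := hκ.mdifferentiableAt_apply dU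
  have db := hκ.mdifferentiableAt_apply dV
  have dc := hκ.mdifferentiableAt_apply dN
  have df2 : MDifferentiableAt (𝓡 3) 𝓘(ℝ) (fun y ↦ f y + f y) x := df.add df
  have daf : MDifferentiableAt (𝓡 3) 𝓘(ℝ) (fun y ↦ κ y (U y) + f y) x := da.add df
  have dna : MDifferentiableAt (𝓡 3) 𝓘(ℝ) (fun y ↦ -(κ y (U y) + f y)) x := daf.neg
  have dnb : MDifferentiableAt (𝓡 3) 𝓘(ℝ) (fun y ↦ -κ y (V y)) x := db.neg
  have dnc : MDifferentiableAt (𝓡 3) 𝓘(ℝ) (fun y ↦ -κ y (N y)) x := dc.neg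
  have J := mlieBracket_jacobi (hM.smooth x) (hc.smooth_v x) (hc.smooth_n x)
  rw [mlieBracket_u_v hM hc hκ, mlieBracket_u_n hM hc hκ, mlieBracket_v_n hM hc hκ,
    mlieBracket_add_right (df2.smul_section dV)
      (mdifferentiableAt_add_section (dnb.smul_section dU) (dnc.smul_section dN)),
    mlieBracket_add_right (dnb.smul_section dU) (dnc.smul_section dN),
    mlieBracket_smul_right df2 dV, mlieBracket_smul_right dnb dU,
    mlieBracket_smul_right dnc dN, mlieBracket_smul_left daf dN,
    mlieBracket_smul_right dna dU, mlieBracket_swap_apply (V := V) (W := U),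
    mlieBracket_u_v hM hc hκ, mlieBracket_u_n hM hc hκ, mlieBracket_self, mlieBracket_self,
    mvfderiv_fun_neg, mvfderiv_fun_neg, mvfderiv_fun_neg, mvfderiv_fun_add df df,
    mvfderiv_fun_add da df] at J
  -- Pairing with `U` extracts the `V`-component, which is `df(U) = 0`; pairing with `V` gives
  -- `dκ(U,V)`, and pairing with `N` gives `dκ(U,N)`.
  have JU := congr(g.inner x $J (U x))
  have JV := congr(g.inner x $J (V x))
  have JN := congr(g.inner x $J (N x))
  simp [h.uu, h.vv, h.uv, h.un, h.vn, h.nn, h.vu, h.nu, h.nv] at JU JV JN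
  simp only [extDerivOneForm, mlieBracket_u_v hM hc hκ, mlieBracket_u_n hM hc hκ, Pi.smul_apply',
    map_smul, smul_eq_mul]
  refine ⟨by linarith, by linarith, by linarith⟩

/-- The exterior derivative of the connection form. -/
theorem extDerivOneForm_connectionForm {X Y : Π x : M, TangentSpace (𝓡 3) x}
    (hX : MDifferentiableAt (𝓡 3) (𝓡 3).tangent (T% X) x)
    (hY : MDifferentiableAt (𝓡 3) (𝓡 3).tangent (T% Y) x) :
    extDerivOneForm κ X Y x =
      mvfderiv (𝓡 3) f x (V x)
          * wedge (g.inner x (V x)) (g.inner x (U x)) (X x) (Y x)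
        + (mvfderiv (𝓡 3) f x (N x) + f x ^ 2 + κ x (U x) * f x)
          * wedge (g.inner x (V x)) (g.inner x (N x)) (X x) (Y x)
        + extDerivOneForm κ V N x
          * wedge (g.inner x (U x)) (g.inner x (N x)) (X x) (Y x) := by
  have h := hM.isNullTriple hc x
  have dU := hM.smooth.mdifferentiableAt x
  have dV := hc.smooth_v.mdifferentiableAt x
  have dN := hc.smooth_n.mdifferentiableAt x
  -- Tensoriality reduces dκ to its values on pairs of frame fields; two are given by the structure
  -- equations and the third is left as it stands.
  obtain ⟨B, hB⟩ := exists_extDerivOneForm_eq_bilinear (I := 𝓡 3) (α := κ) (x := x)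
    fun X hX ↦ hκ.mdifferentiableAt_apply hX
  have swap (X Y : Π x : M, TangentSpace (𝓡 3) x)
      (hX : MDifferentiableAt (𝓡 3) (𝓡 3).tangent (T% X) x)
      (hY : MDifferentiableAt (𝓡 3) (𝓡 3).tangent (T% Y) x) : B (Y x) (X x) = -B (X x) (Y x) := by
    rw [← hB X Y hX hY, ← hB Y X hY hX, extDerivOneForm, extDerivOneForm,
      mlieBracket_swap_apply (V := Y), map_neg]
    ring
  obtain ⟨-, h1, h2⟩ := structure_equations hM hc hκ x
  rw [← h1, ← h2, hB U V dU dV, hB U N dU dN, hB V N dV dN, hB X Y hX hY]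
  have s1 := swap U V dU dV
  have s2 := swap U N dU dN
  have s3 := swap V N dV dN
  have t1 : B (U x) (U x) = 0 := by linarith [swap U U dU dU]
  have t2 : B (V x) (V x) = 0 := by linarith [swap V V dV dV]
  have t3 : B (N x) (N x) = 0 := by linarith [swap N N dN dN]
  conv_lhs => rw [h.expansion (X x), h.expansion (Y x)]
  simp [s1, s2, s3, t1, t2, t3, wedge, g.symm x (X x), g.symm x (Y x)]
  ring

theorem isCurvatureFunction_extDerivOneForm :
    IsCurvatureFunction g U V N f κ (extDerivOneForm κ V N) where
  smooth x :=
    (((hκ.contMDiffAt_apply (hc.smooth_n x)).mvfderiv_apply (hc.smooth_v x)).sub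
      ((hκ.contMDiffAt_apply (hc.smooth_v x)).mvfderiv_apply (hc.smooth_n x))).sub
      (hκ.contMDiffAt_apply ((hc.smooth_v x).mlieBracket_smooth (hc.smooth_n x)))
  extDeriv_eq _ _ hX hY x :=
    extDerivOneForm_connectionForm hM hc hκ (hX.mdifferentiableAt x) (hY.mdifferentiableAt x)

/-- The `v`-component of df is `df(U)`, which the Jacobi identity kills. -/
theorem differential_eq (w : TangentSpace (𝓡 3) x) : mvfderiv (𝓡 3) f x w =
    mvfderiv (𝓡 3) f x (V x) * g.inner x (U x) w
      + mvfderiv (𝓡 3) f x (N x) * g.inner x (N x) w := by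
  conv_lhs => rw [(hM.isNullTriple hc x).expansion w]
  simp [(structure_equations hM hc hκ x).1, g.symm x w]
  ring

/-- The curvature on the field dual to `u`. -/
theorem curvature_u {X Y : Π x : M, TangentSpace (𝓡 3) x}
    (hX : MDifferentiableAt (𝓡 3) (𝓡 3).tangent (T% X) x)
    (hY : MDifferentiableAt (𝓡 3) (𝓡 3).tangent (T% Y) x) :
    g.curvature X Y U x =
      (mvfderiv (𝓡 3) f x (V x) * wedge (g.inner x (U x)) (g.inner x (N x)) (X x) (Y x)
        + f x ^ 2 * wedge (g.inner x (U x)) (g.inner x (V x)) (X x) (Y x)) • U x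
      - ((mvfderiv (𝓡 3) f x (N x) + f x ^ 2)
        * wedge (g.inner x (N x)) (g.inner x (U x)) (X x) (Y x)) • N x := by
  have dU := hM.smooth.mdifferentiableAt x
  have dN := hc.smooth_n.mdifferentiableAt x
  have df := (hM.smooth_function x).mdifferentiableAt (by simp)
  have dnf : MDifferentiableAt (𝓡 3) 𝓘(ℝ) (fun y ↦ -f y) x := df.neg
  have hW (y : M) (w : TangentSpace (𝓡 3) y) : g.leviCivita U y w =
      (f y • g.inner y (N y)) w • U y + ((-f y) • g.inner y (U y)) w • N y := by
    rw [hκ.nabla_u]; simp [sub_eq_add_neg]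
  rw [g.curvature_eq_of_leviCivita_eq hW dU dN
    (fun X hX ↦ df.mul (g.mdifferentiableAt_inner dN hX))
    (fun X hX ↦ dnf.mul (g.mdifferentiableAt_inner dU hX)) hX hY,
    g.extDerivOneForm_smul_flat df dN hX hY, g.extDerivOneForm_smul_flat dnf dU hX hY,
    mvfderiv_fun_neg]
  simp only [hκ.nabla_u, hκ.nabla_n, smul_apply, smul_eq_mul, map_sub, map_smul, sub_apply, wedge,
    neg_apply, differential_eq hM hc hκ (X x), differential_eq hM hc hκ (Y x)]
  module

/-- The coefficient of `N` is `dκ - f κ ∧ n`. Subtracting `f κ ∧ n` removes `κ(U) f` from the `v ∧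
n` term and turns l into `l - f κ(V)` in the `u ∧ n` term, which is the source of the Einstein
condition on l. -/
theorem curvature_v {X Y : Π x : M, TangentSpace (𝓡 3) x}
    (hX : MDifferentiableAt (𝓡 3) (𝓡 3).tangent (T% X) x)
    (hY : MDifferentiableAt (𝓡 3) (𝓡 3).tangent (T% Y) x) :
    g.curvature X Y V x =
      (mvfderiv (𝓡 3) f x (V x) * wedge (g.inner x (V x)) (g.inner x (U x)) (X x) (Y x)
        + (mvfderiv (𝓡 3) f x (N x) + f x ^ 2)
          * wedge (g.inner x (V x)) (g.inner x (N x)) (X x) (Y x)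
        + (extDerivOneForm κ V N x - f x * κ x (V x))
          * wedge (g.inner x (U x)) (g.inner x (N x)) (X x) (Y x)) • N x
      - (mvfderiv (𝓡 3) f x (V x) * wedge (g.inner x (U x)) (g.inner x (N x)) (X x) (Y x)
        + f x ^ 2 * wedge (g.inner x (U x)) (g.inner x (V x)) (X x) (Y x)) • V x := by
  have dV := hc.smooth_v.mdifferentiableAt x
  have dN := hc.smooth_n.mdifferentiableAt x
  have df := (hM.smooth_function x).mdifferentiableAt (by simp)
  have dnf : MDifferentiableAt (𝓡 3) 𝓘(ℝ) (fun y ↦ -f y) x := df.neg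
  have hW (y : M) (w : TangentSpace (𝓡 3) y) : g.leviCivita V y w =
      κ y w • N y + ((-f y) • g.inner y (N y)) w • V y := by
    rw [hκ.nabla_v]; simp [sub_eq_add_neg]
  rw [g.curvature_eq_of_leviCivita_eq hW dN dV (fun X hX ↦ hκ.mdifferentiableAt_apply hX)
    (fun X hX ↦ dnf.mul (g.mdifferentiableAt_inner dN hX)) hX hY,
    g.extDerivOneForm_smul_flat dnf dN hX hY,
    extDerivOneForm_connectionForm hM hc hκ hX hY, mvfderiv_fun_neg]
  simp only [hκ.nabla_v, hκ.nabla_n, smul_apply, smul_eq_mul, map_sub, map_smul, sub_apply, wedge,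
    neg_apply, differential_eq hM hc hκ (X x), differential_eq hM hc hκ (Y x), 
    connectionForm_eq hM hc (X x), connectionForm_eq hM hc (Y x)]
  module

theorem curvature_n {X Y : Π x : M, TangentSpace (𝓡 3) x}
    (hX : MDifferentiableAt (𝓡 3) (𝓡 3).tangent (T% X) x)
    (hY : MDifferentiableAt (𝓡 3) (𝓡 3).tangent (T% Y) x) :
    g.curvature X Y N x =
      ((mvfderiv (𝓡 3) f x (N x) + f x ^ 2)
        * wedge (g.inner x (N x)) (g.inner x (U x)) (X x) (Y x)) • V x
      - (mvfderiv (𝓡 3) f x (V x) * wedge (g.inner x (V x)) (g.inner x (U x)) (X x) (Y x)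
        + (mvfderiv (𝓡 3) f x (N x) + f x ^ 2)
          * wedge (g.inner x (V x)) (g.inner x (N x)) (X x) (Y x)
        + (extDerivOneForm κ V N x - f x * κ x (V x))
          * wedge (g.inner x (U x)) (g.inner x (N x)) (X x) (Y x)) • U x := by
  have dU := hM.smooth.mdifferentiableAt x
  have dV := hc.smooth_v.mdifferentiableAt x
  have df := (hM.smooth_function x).mdifferentiableAt (by simp)
  have dnκ (X : Π x : M, TangentSpace (𝓡 3) x)
      (hX : MDifferentiableAt (𝓡 3) (𝓡 3).tangent (T% X) x) :
      MDifferentiableAt (𝓡 3) 𝓘(ℝ) (fun y ↦ (-κ y) (X y)) x :=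
    (hκ.mdifferentiableAt_apply hX).neg
  have hW (y : M) (w : TangentSpace (𝓡 3) y) : g.leviCivita N y w =
      (f y • g.inner y (U y)) w • V y + (-κ y) w • U y := by
    rw [hκ.nabla_n]; simp [sub_eq_add_neg]
  have hneg : extDerivOneForm (fun y ↦ -κ y) X Y x = -extDerivOneForm κ X Y x := by
    simp only [extDerivOneForm, neg_apply, mvfderiv_fun_neg]
    ring
  rw [g.curvature_eq_of_leviCivita_eq hW dV dU
    (fun X hX ↦ df.mul (g.mdifferentiableAt_inner dU hX)) dnκ hX hY,
    g.extDerivOneForm_smul_flat df dU hX hY, hneg,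
    extDerivOneForm_connectionForm hM hc hκ hX hY]
  simp only [hκ.nabla_v, hκ.nabla_u, smul_apply, smul_eq_mul, map_sub, map_smul, sub_apply, wedge,
    neg_apply, differential_eq hM hc hκ (X x), differential_eq hM hc hκ (Y x),
    connectionForm_eq hM hc (X x), connectionForm_eq hM hc (Y x)]
  module

end ConnectionForm

/-! ### Functions with vanishing differential. -/

section Constant

/-- A differentiable function with vanishing differential on a connected manifold is constant. -/
theorem exists_eq_const_of_mvfderiv_eq_zero {E : Type*} [NormedAddCommGroup E] [NormedSpace ℝ E]
    {H : Type*} [TopologicalSpace H] {I : ModelWithCorners ℝ E H} [I.Boundaryless]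
    {M : Type*} [TopologicalSpace M] [ChartedSpace H M] [IsManifold I ∞ M] [ConnectedSpace M]
    {φ : M → ℝ} (hφ : MDifferentiable I 𝓘(ℝ) φ) (h0 : ∀ x, mvfderiv I φ x = 0) :
    ∃ c, ∀ x, φ x = c := by
  have h0' (x : M) : mfderiv I 𝓘(ℝ) φ x = 0 := by
    ext v
    exact congr($(h0 x) v)
  have hloc : IsLocallyConstant φ := by
    rw [IsLocallyConstant.iff_eventually_eq]
    intro x
    -- Without boundary, the chart target contains a ball around the image of `x`. The ball is
    -- convex, so zero derivative makes the function constant there; connectedness of `M` then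
    -- globalises local constancy.
    obtain ⟨r, hr, hball⟩ := Metric.mem_nhds_iff.1 (extChartAt_target_mem_nhds (I := I) x)
    have hd (y) (hy : y ∈ Metric.ball (extChartAt I x x) r) :
        HasFDerivAt (φ ∘ (extChartAt I x).symm) (0 : E →L[ℝ] ℝ) y := by
      have h1 : MDifferentiableAt 𝓘(ℝ, E) I (extChartAt I x).symm y :=
        ((contMDiffOn_extChartAt_symm (n := 1) x).contMDiffAt
          ((isOpen_extChartAt_target x).mem_nhds (hball hy))).mdifferentiableAt (by simp)
      have h2 := (hφ ((extChartAt I x).symm y)).hasMFDerivAt.comp y h1.hasMFDerivAt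
      rw [h0'] at h2
      exact h2.hasFDerivAt.congr_fderiv (ContinuousLinearMap.zero_comp _)
    have hconst {y} (hy : y ∈ Metric.ball (extChartAt I x x) r) :=
      (convex_ball (extChartAt I x x) r).is_const_of_fderivWithin_eq_zero (𝕜 := ℝ)
      (f := φ ∘ (extChartAt I x).symm)
      (fun y hy ↦ (hd y hy).differentiableAt.differentiableWithinAt)
      (fun y hy ↦ by
        rw [fderivWithin_of_isOpen Metric.isOpen_ball hy, (hd y hy).fderiv])
      hy (Metric.mem_ball_self hr)
    filter_upwards [extChartAt_source_mem_nhds (I := I) x,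
      (continuousAt_extChartAt (I := I) x).preimage_mem_nhds (Metric.ball_mem_nhds _ hr)]
      with y hy1 hy2
    have h := hconst hy2
    rwa [Function.comp_apply, Function.comp_apply, (extChartAt I x).left_inv hy1,
      extChartAt_to_inv] at h
  obtain ⟨x₀⟩ := (inferInstance : Nonempty M)
  exact ⟨φ x₀, fun x ↦ hloc.apply_eq_of_preconnectedSpace x x₀⟩

end Constant

/-! ### The Ricci tensor in a null coframe. -/

section Ricci

variable {M : Type*} [TopologicalSpace M] [ChartedSpace (EuclideanSpace ℝ (Fin 3)) M]
  [IsManifold (𝓡 3) ∞ M] {g : PseudoRiemannianMetric (𝓡 3) M}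
  {ν : Π x : M, TangentSpace (𝓡 3) x [⋀^Fin 3]→ₗ[ℝ] ℝ}
  {U V N : Π x : M, TangentSpace (𝓡 3) x} {f l : M → ℝ}
  {κ : Π x : M, TangentSpace (𝓡 3) x →L[ℝ] ℝ}

/-- The Ricci tensor as the trace of an endomorphism. -/
theorem ricci_eq_trace {x : M} {v w : TangentSpace (𝓡 3) x}
    (L : TangentSpace (𝓡 3) x →ₗ[ℝ] TangentSpace (𝓡 3) x)
    (hL : ∀ a, g.curvature (extend (EuclideanSpace ℝ (Fin 3)) a)
      (extend (EuclideanSpace ℝ (Fin 3)) v) (extend (EuclideanSpace ℝ (Fin 3)) w) x = L a) :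
    g.ricci x v w = LinearMap.trace ℝ _ L := by
  have : FiniteDimensional ℝ (TangentSpace (𝓡 3) x) :=
    inferInstanceAs (FiniteDimensional ℝ (EuclideanSpace ℝ (Fin 3)))
  rw [LinearMap.trace_eq_matrix_trace ℝ (Module.finBasis ℝ (TangentSpace (𝓡 3) x)), Matrix.trace]
  simp only [PseudoRiemannianMetric.ricci, hL]
  simp [LinearMap.toMatrix_apply]

variable (hM : IsSkewTorsion g ν U f) (hc : IsNullCoframe g ν U V N)
  (hκ : IsConnectionForm g U V N f κ)
include hM hc hκ

/-- The Ricci tensor of a skew-torsion Lorentzian three-manifold. -/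
theorem ricci_null_coframe (x : M) (v w : TangentSpace (𝓡 3) x) :
    g.ricci x v w =
      -(2 * f x ^ 2 + mvfderiv (𝓡 3) f x (N x))
          * (g.inner x (U x) v * g.inner x (V x) w + g.inner x (V x) v * g.inner x (U x) w)
        - 2 * (f x ^ 2 + mvfderiv (𝓡 3) f x (N x)) * (g.inner x (N x) v * g.inner x (N x) w)
        - mvfderiv (𝓡 3) f x (V x)
          * (g.inner x (U x) v * g.inner x (N x) w + g.inner x (N x) v * g.inner x (U x) w)
        - (extDerivOneForm κ V N x - f x * κ x (V x))
          * (g.inner x (U x) v * g.inner x (U x) w) := by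
  have h := hM.isNullTriple hc x
  -- The three curvature two-forms with second argument `v`: `R(a,v)` sends `U` to `A U - B N`, `V`
  -- to `C N - A V` and `N` to `B V - C U`.
  let A (a : TangentSpace (𝓡 3) x) : ℝ :=
    mvfderiv (𝓡 3) f x (V x) * wedge (g.inner x (U x)) (g.inner x (N x)) a v
      + f x ^ 2 * wedge (g.inner x (U x)) (g.inner x (V x)) a v
  let B (a : TangentSpace (𝓡 3) x) : ℝ :=
    (mvfderiv (𝓡 3) f x (N x) + f x ^ 2) * wedge (g.inner x (N x)) (g.inner x (U x)) a v
  let C (a : TangentSpace (𝓡 3) x) : ℝ :=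
    mvfderiv (𝓡 3) f x (V x) * wedge (g.inner x (V x)) (g.inner x (U x)) a v
      + (mvfderiv (𝓡 3) f x (N x) + f x ^ 2)
        * wedge (g.inner x (V x)) (g.inner x (N x)) a v
      + (extDerivOneForm κ V N x - f x * κ x (V x))
        * wedge (g.inner x (U x)) (g.inner x (N x)) a v
  let L : TangentSpace (𝓡 3) x →ₗ[ℝ] TangentSpace (𝓡 3) x :=
    { toFun := fun a ↦ (A a * g.inner x (V x) w - C a * g.inner x (N x) w) • U x
        + (B a * g.inner x (N x) w - A a * g.inner x (U x) w) • V x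
        + (C a * g.inner x (U x) w - B a * g.inner x (V x) w) • N x
      map_add' := fun a b ↦ by
        simp only [A, B, C, wedge, map_add]
        module
      map_smul' := fun c a ↦ by
        simp only [A, B, C, wedge, map_smul, smul_eq_mul, RingHom.id_apply]
        module }
  have hL (a : TangentSpace (𝓡 3) x) : g.curvature (extend (EuclideanSpace ℝ (Fin 3)) a)
      (extend (EuclideanSpace ℝ (Fin 3)) v) (extend (EuclideanSpace ℝ (Fin 3)) w) x = L a := by
    have sa := contMDiffAt_extend (k := ∞) (𝓡 3) (EuclideanSpace ℝ (Fin 3)) a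
    have sv := contMDiffAt_extend (k := ∞) (𝓡 3) (EuclideanSpace ℝ (Fin 3)) v
    have sw := contMDiffAt_extend (k := ∞) (𝓡 3) (EuclideanSpace ℝ (Fin 3)) w
    have da := sa.mdifferentiableAt (by simp)
    have dv := sv.mdifferentiableAt (by simp)
    have smooth {Y Z : Π x : M, TangentSpace (𝓡 3) x}
        (hY : ContMDiffAt (𝓡 3) (𝓡 3).tangent ∞ (T% Y) x)
        (hZ : ContMDiffAt (𝓡 3) (𝓡 3).tangent ∞ (T% Z) x) :
        MDifferentiableAt (𝓡 3) (𝓡 3).tangent (T% (fun y ↦ g.leviCivita Z y (Y y))) x :=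
      (contMDiffAt_leviCivita_null_frame hM.smooth hc.smooth_v hc.smooth_n
        (hM.isNullTriple hc) hY hZ).mdifferentiableAt (by simp)
    -- The Ricci tensor uses an arbitrary extension of `w`, whereas the curvature is known on the
    -- frame fields. Skew-adjointness moves the curvature from the extension to the frame.
    have skew (W : Π x : M, TangentSpace (𝓡 3) x) (hW : IsSmoothField W) :=
      g.inner_curvature_skew sa sv sw (hW x) (smooth sa sw) (smooth sv sw) (smooth sa (hW x))
        (smooth sv (hW x))
    have sU := skew U hM.smooth
    have sV := skew V hc.smooth_v
    have sN := skew N hc.smooth_n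
    rw [curvature_u hM hc hκ da dv] at sU
    rw [curvature_v hM hc hκ da dv] at sV
    rw [curvature_n hM hc hκ da dv] at sN
    simp only [extend_apply_self, map_sub, map_smul, sub_apply, smul_apply, smul_eq_mul,
      g.symm x w] at sU sV sN
    rw [h.expansion (g.curvature _ _ _ x), sU, sV, sN]
    simp only [L, A, B, C, LinearMap.coe_mk, AddHom.coe_mk]
    module
  rw [ricci_eq_trace L hL, h.trace_eq]
  simp [L, A, B, C, wedge, h.uu, h.vv, h.uv, h.un, h.vn, h.nn, h.vu, h.nu, h.nv]
  ring

end Ricci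

end

/-! ### The Einstein condition. -/

theorem mainTheorem9 {M : Type*} [TopologicalSpace M] [T2Space M] [SecondCountableTopology M]
    [ConnectedSpace M] [ChartedSpace (EuclideanSpace ℝ (Fin 3)) M] [IsManifold (𝓡 3) ∞ M]
    (g : PseudoRiemannianMetric (𝓡 3) M)
    (ν : Π x : M, TangentSpace (𝓡 3) x [⋀^Fin 3]→ₗ[ℝ] ℝ)
    (U : Π x : M, TangentSpace (𝓡 3) x) (f : M → ℝ) (hM : IsSkewTorsion g ν U f)
    (V N : Π x : M, TangentSpace (𝓡 3) x) (hc : IsNullCoframe g ν U V N) :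
    (∃ κ l, IsConnectionForm g U V N f κ ∧ IsCurvatureFunction g U V N f κ l) ∧
    ∀ κ l, IsConnectionForm g U V N f κ → IsCurvatureFunction g U V N f κ l →
      (g.IsEinstein ↔ (∃ c, ∀ x, f x = c) ∧ ∀ x, f x * κ x (V x) = l x) := by
  refine ⟨?_, fun κ l hκ hl ↦ ⟨?_, ?_⟩⟩
  · obtain ⟨κ, hκ⟩ := hM.exists_isConnectionForm hc
    exact ⟨κ, _, hκ, isCurvatureFunction_extDerivOneForm hM hc hκ⟩
  · rintro ⟨c, hE⟩
    have key (x : M) : mvfderiv (𝓡 3) f x (N x) = 0 ∧ mvfderiv (𝓡 3) f x (V x) = 0 ∧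
        f x * κ x (V x) = l x := by
      have h := hM.isNullTriple hc x
      -- The `(U,V)` and `(N,N)` components give `-(2f² + df(N))` and `-2(f² + df(N))`; both equal
      -- the Einstein constant, so `df(N) = 0`. The `(V,N)` and `(V,V)` components, where g
      -- vanishes, give `df(V) = 0` and `l = f κ(V)`.
      have e1 := hE x (U x) (V x)
      have e2 := hE x (N x) (N x)
      have e3 := hE x (V x) (N x)
      have e4 := hE x (V x) (V x)
      rw [ricci_null_coframe hM hc hκ] at e1 e2 e3 e4
      simp only [h.uu, h.vv, h.uv, h.un, h.vn, h.nn, h.vu, h.nu, h.nv] at e1 e2 e3 e4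
      rw [hl.eq_extDerivOneForm hM hc]
      exact ⟨by linarith, by linarith, by linarith⟩
    refine ⟨exists_eq_const_of_mvfderiv_eq_zero
      (fun x ↦ (hM.smooth_function x).mdifferentiableAt (by simp)) fun x ↦ ?_, fun x ↦ (key x).2.2⟩
    ext w
    rw [differential_eq hM hc hκ, (key x).1, (key x).2.1]
    simp
  · rintro ⟨⟨c, hf⟩, hfl⟩
    -- With `df = 0` and `l = f κ(V)` the Ricci tensor reduces to `-2f² (u⊗v + v⊗u + n⊗n)`.
    refine ⟨-2 * c ^ 2, fun x v w ↦ ?_⟩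
    have h0 : mvfderiv (𝓡 3) f x = 0 := by rw [funext hf, mvfderiv_const]
    rw [ricci_null_coframe hM hc hκ, h0, ← hl.eq_extDerivOneForm hM hc, ← hfl, hf,
      (hM.isNullTriple hc x).inner_eq v w]
    simp [g.symm x v, g.symm x w]
    ring
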